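/- **Corollary 3 (Converse Measure Concentration).** Let $A$ be a finite set, $P$ a probability distribution on $A$ with $P(a)>0$ for all $a\in A$, and $\rho:A\times A\to[0,\infty)$ a function such that for each $a\in A$ there is a $b\in A$ with $\rho(a,b)=0$. For $x,y\in A^n$ let $\rho_n(x,y)=\frac1n\sum_{i=1}^n\rho(x_i,y_i)$, and for $C\subset A^n$ and $D\ge 0$ let $[C]_D=\bigcup_{y\in C}\{x\in A^n:\rho_n(x,y)\le D\}$. Let $P^n$ denote the product distribution on $A^n$. A $D$-covering is a sequence of sets $C_n\subset A^n$, $n\ge1$, whose probability of error $1-P^n([C_n]_D)$ is exponentially small, i.e. $\liminf_{n\to\infty}-\frac1n\ln\big[1-P^n([C_n]_D)\big]>0$ (with $\ln 0=-\infty$). For a distribution $Q$ on $A$ let $H_e(Q\|P)$ denote relative entropy in nats, and let $$R_e(D;Q,P)=\inf_{(X,Y)\,:\,X\sim Q,\;E\rho(X,Y)\le D}\Big\{H_e(P_{X,Y}\|Q\times P_Y)+E[\ln P(Y)]\Big\},$$ where $P_{X,Y}$ is the joint distribution of the $A\times A$-valued pair $(X,Y)$ and $P_Y$ is the distribution of $Y$.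 Let $D\ge0$ and $0<r<-R_e(D;P,P)$, and put $$\mathcal E^*(r,D)=\inf_{Q\,:\,R_e(D;Q,P)>-r}H_e(Q\|P)\in[0,\infty],\qquad \inf\emptyset=+\infty.$$ Then $\mathcal E^*(r,D)$ is the fastest achievable asymptotic rate of decay of the probability of error among all $D$-coverings with $$\limsup_{n\to\infty}\tfrac1n\ln P^n(C_n)\le -r .\qquad(*)$$ That is: 1. $\displaystyle\sup_{\{C_n\}}\ \liminf_{n\to\infty}-\tfrac1n\ln\big[1-P^n([C_n]_D)\big]=\mathcal E^*(r,D)$, the supremum being over all sequences of sets $C_n\subset A^n$ with $(*)$; 2. every sequence of sets $C_n\subset A^n$ with $(*)$ satisfies $\displaystyle\limsup_{n\to\infty}-\tfrac1n\ln\big[1-P^n([C_n]_D)\big]\le\mathcal E^*(r,D)$; 3. there is a $D$-covering $\{C_n\}$ with $(*)$ and $\displaystyle\lim_{n\to\infty}-\tfrac1n\ln\big[1-P^n([C_n]_D)\big]=\mathcal E^*(r,D)$. -/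

import Mathlib

open MeasureTheory Filter Topology

namespace Covering

noncomputable section

/-- The coordinate-wise (single-letter) distortion on `A ^ n`. -/
def distortion {A : Type*} (ρ : A → A → ℝ) (n : ℕ) (x y : Fin n → A) : ℝ :=
  (1 / (n : ℝ)) * ∑ i, ρ (x i) (y i)

/-- The closed ball `B(y, D)`: the strings `x` with `ρ_n(x, y) ≤ D`. -/
def ball {A : Type*} (ρ : A → A → ℝ) (D : ℝ) (n : ℕ) (y : Fin n → A) : Set (Fin n → A) :=
  {x | distortion ρ n x y ≤ D}

/-- The `D`-blowup of a set of strings. -/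
def blowup {A : Type*} (ρ : A → A → ℝ) (D : ℝ) (n : ℕ) (C : Set (Fin n → A)) :
    Set (Fin n → A) :=
  ⋃ y ∈ C, ball ρ D n y

/-- The product distribution `P ^ n` on `A ^ n`. -/
def prodMeasure {A : Type*} [MeasurableSpace A] (P : Measure A) (n : ℕ) :
    Measure (Fin n → A) :=
  Measure.pi fun _ => P

/-- The probability of error, `1 - P ^ n ([C]_D)`. -/
def errorProb {A : Type*} [MeasurableSpace A] (P : Measure A) (ρ : A → A → ℝ) (D : ℝ) (n : ℕ)
    (C : Set (Fin n → A)) : ENNReal :=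
  1 - prodMeasure P n (blowup ρ D n C)

/-- `-(1 / n) ln (1 - P ^ n ([C]_D))`, an extended real (it is `⊤` if the error vanishes). -/
def errorRate {A : Type*} [MeasurableSpace A] (P : Measure A) (ρ : A → A → ℝ) (D : ℝ) (n : ℕ)
    (C : Set (Fin n → A)) : EReal :=
  -(ENNReal.log (errorProb P ρ D n C) / (n : EReal))

/-- `C` is a `D`-covering: its probability of error is exponentially small. -/
def IsDCovering {A : Type*} [MeasurableSpace A] (P : Measure A) (ρ : A → A → ℝ) (D : ℝ)
    (C : (n : ℕ) → Set (Fin n → A)) : Prop :=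
  0 < liminf (fun n => errorRate P ρ D n (C n)) atTop

/-- `limsup (1 / n) ln P ^ n (C_n) ≤ -r`, where `ln 0 = -∞`. -/
def ProbBound {A : Type*} [MeasurableSpace A] (P : Measure A) (r : ℝ)
    (C : (n : ℕ) → Set (Fin n → A)) : Prop :=
  limsup (fun n : ℕ => ENNReal.log (prodMeasure P n (C n)) / (n : EReal)) atTop ≤ ((-r : ℝ) : EReal)

/-- The best achievable error exponent among the sequences of sets whose probability is
asymptotically bounded by `exp (-n r)`. -/
def bestExponent {A : Type*} [MeasurableSpace A] (P : Measure A) (ρ : A → A → ℝ) (r D : ℝ) :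
    EReal :=
  ⨆ (C : (n : ℕ) → Set (Fin n → A)) (_ : ProbBound P r C),
    liminf (fun n => errorRate P ρ D n (C n)) atTop

/-- `R_e(D; Q, M)`, in nats: the infimum of `H_e(P_{X,Y} ‖ Q × P_Y) + E[ln M(Y)]` over all joint
distributions `π` of `(X, Y)` with `X ∼ Q` and `E[ρ(X, Y)] ≤ D`. -/
def rateFn {A : Type*} [MeasurableSpace A] (ρ : A → A → ℝ) (D : ℝ) (Q : Measure A) (M : A → ℝ) :
    EReal :=
  ⨅ (π : ProbabilityMeasure (A × A)) (_ : (π : Measure (A × A)).fst = Q)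
    (_ : ∫ z, ρ z.1 z.2 ∂(π : Measure (A × A)) ≤ D),
    ((InformationTheory.klDiv (π : Measure (A × A)) (Q.prod (π : Measure (A × A)).snd) : ENNReal) :
      EReal) + ((∫ z, Real.log (M z.2) ∂(π : Measure (A × A)) : ℝ) : EReal)

/-- The exponent `inf {H_e(Q ‖ P) : R_e(D; Q, P) > -r}`, which is `⊤` if there is no such `Q`. -/
def optExponent {A : Type*} [MeasurableSpace A] (P : Measure A) (ρ : A → A → ℝ) (r D : ℝ) :
    EReal :=
  ⨅ (Q : ProbabilityMeasure A)
    (_ : ((-r : ℝ) : EReal) < rateFn ρ D (Q : Measure A) (fun a => P.real {a})),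
    ((InformationTheory.klDiv (Q : Measure A) P : ENNReal) : EReal)

end

end Covering

/-!
The proof is the method of types. The type of a string records how often each letter occurs in it.
There are only polynomially many types, and a type class has `exp (n H)` elements up to polynomial
factors, where `H` is the entropy of the type (`card_typeClass_le`, `exp_le_card_typeClass`). So on
the exponential scale everything is decided type by type, and the type class of frequencies `q` has
probability about `exp (-n H(q ‖ P))`.

Converse. Let `C` have probability about `exp (-n r)`, and let `κ` range over the joint types with
first marginal `q` and distortion at most `D`. The strings of type `q` that have joint type `κ` with
some element of `C` form at most a fraction `exp (-n (r + I(X; Y) + E[ln P(Y)]))` of the type class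
(`card_covered_le`), which vanishes if the rate function at `q` exceeds `-r`. The error probability
is then at least about `exp (-n H(q ‖ P))`. Lower semicontinuity of the rate function in `q` allows
an arbitrary distribution to be replaced by types that converge to it (`eventually_forall_lt_cost`).

Achievability. If the rate function at the type `q` is at most `-r`, a near-optimal coupling is
rounded to a joint type with first marginal `q` and no larger distortion, which is possible because
each letter has another one at distortion zero (`exists_jointType_near`). Greedy covering
(`exists_cover`) then covers the type class by strings of total probability about `exp (-n r)`
(`exists_cover_typeClass`). The union over all such types leaves uncovered only types at which the
rate function exceeds `-r`, and these have total probability about `exp (-n E)`, with `E` the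
optimal exponent.

The exponent is positive because the rate function is upper semicontinuous at `P`
(`eventually_exists_cost_lt`), so that it exceeds `-r` only at distributions away from `P`.
-/

set_option linter.unusedSectionVars false

namespace Covering

/-! ### Type classes and their cardinality -/

section TypeClasses

open Finset

/-- The number of occurrences of the letter `a` in the string `x`. -/
def letterCount {A : Type*} [DecidableEq A] {n : ℕ} (x : Fin n → A) (a : A) : ℕ :=
  #{i | x i = a}

/-- The type class of `k`: the strings of length `n` in which each letter `a` occurs exactly `k a`
times. A type is recorded by its integer counts rather than by the frequencies `k a / n`. -/
def typeClass {A : Type*} [Fintype A] [DecidableEq A] (n : ℕ) (k : A → ℕ) : Finset (Fin n → A) :=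
  {x | letterCount x = k}

/-- The push-forward along `φ` of a family of weights. It is used both for counts (`M = ℕ`) and for
probabilities (`M = ℝ`); for `φ = Prod.fst` and `φ = Prod.snd` it gives the two marginals. -/
def marginal {A B M : Type*} [Fintype A] [DecidableEq B] [AddCommMonoid M] (φ : A → B)
    (p : A → M) (b : B) : M :=
  ∑ a with φ a = b, p a

variable {A B : Type*} [Fintype A] [DecidableEq A] [Fintype B] [DecidableEq B] {n : ℕ}

lemma mem_typeClass {k : A → ℕ} {x : Fin n → A} : x ∈ typeClass n k ↔ letterCount x = k := by
  simp [typeClass]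

lemma sum_marginal {M : Type*} [AddCommMonoid M] (φ : A → B) (p : A → M) :
    ∑ b, marginal φ p b = ∑ a, p a := by
  unfold marginal
  exact sum_fiberwise _ _ _

lemma sum_marginal_mul (φ : A → B) (p : A → ℝ) (g : B → ℝ) :
    ∑ b, marginal φ p b * g b = ∑ a, p a * g (φ a) := by
  unfold marginal
  rw [← sum_fiberwise (s := univ) (g := φ)]
  refine sum_congr rfl fun b _ => ?_
  rw [sum_mul]
  refine sum_congr rfl fun a ha => ?_
  rw [(mem_filter.1 ha).2]

lemma sum_letterCount (x : Fin n → A) : ∑ a, letterCount x a = n := by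
  have := card_eq_sum_card_fiberwise (s := (univ : Finset (Fin n))) (t := (univ : Finset A))
    (f := x) (fun _ _ => by simp)
  simpa [letterCount] using this.symm

lemma sum_comp_eq_sum_letterCount (x : Fin n → A) (g : A → ℝ) :
    ∑ i, g (x i) = ∑ a, (letterCount x a : ℝ) * g a := by
  rw [← sum_fiberwise (s := univ) (g := x)]
  refine sum_congr rfl fun a _ => ?_
  rw [sum_congr rfl (g := fun _ => g a) (fun i hi => by rw [(mem_filter.1 hi).2])]
  simp [letterCount]

lemma marginal_letterCount (φ : A → B) (z : Fin n → A) :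
    marginal φ (letterCount z) = letterCount (φ ∘ z) := by
  ext b
  have := card_eq_sum_card_fiberwise (s := ({i | φ (z i) = b} : Finset (Fin n)))
    (t := ({a | φ a = b} : Finset A)) (f := z) (fun i hi => by simpa using hi)
  unfold letterCount marginal
  simp only [Function.comp_apply]
  rw [this]
  refine sum_congr rfl fun a ha => ?_
  congr 1
  ext i
  simp only [mem_filter, mem_univ, true_and] at ha ⊢
  constructor
  · rintro rfl; exact ⟨ha, rfl⟩
  · exact fun h => h.2

lemma letterCount_comp_perm (x : Fin n → A) (σ : Equiv.Perm (Fin n)) :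
    letterCount (x ∘ σ) = letterCount x := by
  ext a
  unfold letterCount
  refine card_bij (fun i _ => σ i) (by simp) (by simp) fun i hi => ⟨σ.symm i, by simpa using hi, ?_⟩
  simp

/-- The symmetric group acts transitively on each type class. -/
lemma exists_perm_of_letterCount_eq {x y : Fin n → A} (h : letterCount x = letterCount y) :
    ∃ σ : Equiv.Perm (Fin n), x ∘ σ = y := by
  have e : ∀ c, {i // y i = c} ≃ {i // x i = c} := fun c => Fintype.equivOfCardEq (by
    rw [Fintype.card_subtype, Fintype.card_subtype]
    exact (congrFun h c).symm)
  exact ⟨Equiv.ofFiberEquiv e, funext fun i => Equiv.ofFiberEquiv_map e i⟩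

lemma typeClass_nonempty {k : A → ℕ} (hk : ∑ a, k a = n) : (typeClass n k).Nonempty := by
  have e : (Σ a, Fin (k a)) ≃ Fin n := Fintype.equivOfCardEq (by simp [hk])
  refine ⟨fun i => (e.symm i).1, mem_typeClass.2 (funext fun a => ?_)⟩
  unfold letterCount
  have : #(univ : Finset (Fin (k a))) = #{i | (e.symm i).1 = a} := by
    refine card_bij (fun j _ => e ⟨a, j⟩) (by simp) (by simp) fun i hi => ?_
    simp only [mem_filter, mem_univ, true_and] at hi
    subst hi
    exact ⟨(e.symm i).2, mem_univ _, by simp⟩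
  rw [← this, card_univ, Fintype.card_fin]

/-- The type class of `k` has multinomial cardinality `n! / ∏ (k a)!`. -/
lemma card_typeClass_mul_prod_factorial {k : A → ℕ} (hk : ∑ a, k a = n) :
    #(typeClass n k) * ∏ a, (k a).factorial = n.factorial := by
  obtain ⟨x, hx⟩ := typeClass_nonempty hk
  have hx' := mem_typeClass.1 hx
  have h1 := card_eq_sum_card_fiberwise (s := (univ : Finset (Equiv.Perm (Fin n))))
    (t := typeClass n k) (f := fun σ : Equiv.Perm (Fin n) => x ∘ σ)
    (fun σ _ => by simp [mem_typeClass, letterCount_comp_perm, hx'])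
  have h2 : ∀ y ∈ typeClass n k, #{σ : Equiv.Perm (Fin n) | x ∘ σ = y} =
      ∏ a, (k a).factorial := by
    intro y hy
    obtain ⟨τ, rfl⟩ := exists_perm_of_letterCount_eq (hx'.trans (mem_typeClass.1 hy).symm)
    have h3 := DomMulAct.stabilizer_card x
    rw [Fintype.card_subtype] at h3
    have h4 : ∏ a, (Fintype.card {i // x i = a}).factorial = ∏ a, (k a).factorial := by
      refine prod_congr rfl fun a _ => ?_
      rw [Fintype.card_subtype, ← hx']
      rfl
    rw [← h4, ← h3]
    refine card_bij (fun σ _ => σ * τ⁻¹) ?_ (by simp) ?_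
    · intro σ hσ
      simp only [mem_filter, mem_univ, true_and] at hσ ⊢
      funext i
      simpa using congrFun hσ (τ⁻¹ i)
    · intro σ hσ
      simp only [mem_filter, mem_univ, true_and] at hσ
      refine ⟨σ * τ, ?_, by simp⟩
      simp only [mem_filter, mem_univ, true_and]
      funext i
      simpa using congrFun hσ (τ i)
  rw [sum_congr rfl h2] at h1
  simpa [Fintype.card_perm] using h1.symm

/-- All the fibres of the map that a letter map `φ` induces between type classes have the same
cardinality. -/
lemma card_fiber_mul_card_typeClass (φ : A → B) (κ : A → ℕ) {y : Fin n → B}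
    (hy : y ∈ typeClass n (marginal φ κ)) :
    #{z ∈ typeClass n κ | φ ∘ z = y} * #(typeClass n (marginal φ κ)) = #(typeClass n κ) := by
  have h1 := card_eq_sum_card_fiberwise (s := typeClass n κ)
    (t := typeClass n (marginal φ κ)) (f := fun z => φ ∘ z)
    (fun z hz => by
      have hz := mem_typeClass.1 hz
      simp [mem_typeClass, ← hz, marginal_letterCount])
  have h2 : ∀ y' ∈ typeClass n (marginal φ κ), #{z ∈ typeClass n κ | φ ∘ z = y'} =
      #{z ∈ typeClass n κ | φ ∘ z = y} := by
    intro y' hy'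
    obtain ⟨τ, rfl⟩ := exists_perm_of_letterCount_eq
      ((mem_typeClass.1 hy').trans (mem_typeClass.1 hy).symm)
    refine card_bij (fun z _ => z ∘ τ) ?_ ?_ ?_
    · intro z hz
      simp only [mem_filter, mem_typeClass, letterCount_comp_perm] at hz ⊢
      exact ⟨hz.1, by rw [← hz.2]; rfl⟩
    · intro z _ z' _ h
      funext i
      simpa using congrFun h (τ⁻¹ i)
    · intro z hz
      simp only [mem_filter, mem_typeClass] at hz
      refine ⟨z ∘ τ.symm, ?_, by funext i; simp⟩
      simp only [mem_filter, mem_typeClass, letterCount_comp_perm]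
      refine ⟨hz.1, ?_⟩
      rw [← Function.comp_assoc, hz.2]
      funext i; simp
  rw [sum_congr rfl h2, sum_const, smul_eq_mul, mul_comm] at h1
  exact h1.symm

lemma card_piAntidiag_le (A : Type*) [Fintype A] [DecidableEq A] (n : ℕ) :
    #(piAntidiag (univ : Finset A) n) ≤ (n + 1) ^ Fintype.card A := by
  have : piAntidiag (univ : Finset A) n ⊆ Fintype.piFinset fun _ => range (n + 1) := by
    intro k hk
    simp only [mem_piAntidiag, mem_univ, implies_true, and_true] at hk
    simp only [Fintype.mem_piFinset, mem_range, Nat.lt_succ_iff]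
    exact fun a => hk ▸ single_le_sum (f := k) (fun _ _ => Nat.zero_le _) (mem_univ a)
  simpa using card_le_card this

end TypeClasses

/-! ### Entropy estimates for type classes -/

section Entropy

open Finset

/-- The Shannon entropy, in nats, of a vector of weights. -/
noncomputable def entropy {A : Type*} [Fintype A] (p : A → ℝ) : ℝ :=
  ∑ a, Real.negMulLog (p a)

/-- The vector of frequencies `k a / n` of a type given by its counts `k`. -/
noncomputable def freq {A : Type*} (n : ℕ) (k : A → ℕ) (a : A) : ℝ :=
  (k a : ℝ) / n

/-- The logarithmic error term in the estimates below. A factor `exp (K * polyLog n)` with `K`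
constant is polynomial in `n`, hence negligible on the exponential scale. -/
noncomputable def polyLog (n : ℕ) : ℝ :=
  1 + Real.log (n + 1)

lemma one_le_polyLog (n : ℕ) : 1 ≤ polyLog n := by
  have : 0 ≤ Real.log ((n : ℝ) + 1) := Real.log_nonneg (by linarith [Nat.cast_nonneg (α := ℝ) n])
  unfold polyLog; linarith

lemma polyLog_mono {m n : ℕ} (h : m ≤ n) : polyLog m ≤ polyLog n := by
  unfold polyLog
  have : (m : ℝ) ≤ n := by exact_mod_cast h
  gcongr

lemma add_one_pow_le_exp_polyLog (n K : ℕ) :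
    ((n : ℝ) + 1) ^ K ≤ Real.exp (K * polyLog n) := by
  have h : (0 : ℝ) < (n : ℝ) + 1 := by positivity
  rw [← Real.exp_log (pow_pos h K), Real.log_pow]
  gcongr
  unfold polyLog; linarith

lemma le_log_factorial (n : ℕ) : n * Real.log n - n ≤ Real.log n.factorial := by
  rcases Nat.eq_zero_or_pos n with rfl | hn
  · simp
  have h := Real.pow_div_factorial_le_exp (n : ℝ) (Nat.cast_nonneg n) n
  have hn' : (0 : ℝ) < n := by exact_mod_cast hn
  have hf : (0 : ℝ) < n.factorial := by exact_mod_cast n.factorial_pos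
  have := Real.log_le_log (by positivity) h
  rw [Real.log_exp, Real.log_div (by positivity) hf.ne', Real.log_pow] at this
  linarith

lemma log_factorial_le (n : ℕ) :
    Real.log n.factorial ≤ n * Real.log n - n + polyLog n := by
  have key : ∀ m : ℕ, Real.log (m + 1).factorial ≤
      (m + 1) * Real.log (m + 1) - (m + 1) + (1 + Real.log (m + 1)) := by
    intro m
    induction m with
    | zero => simp
    | succ m ih =>
      have hm : (0 : ℝ) < (m : ℝ) + 1 := by positivity
      have h1 : Real.log (m + 1 + 1).factorial =
          Real.log (m + 1 + 1) + Real.log (m + 1).factorial := by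
        rw [Nat.factorial_succ, Nat.cast_mul, Real.log_mul (by positivity)
          (by exact_mod_cast (m + 1).factorial_ne_zero)]
        push_cast; rfl
      -- `log (1 + 1 / (m + 1)) ≥ 1 / (m + 2)`
      have h2 := Real.one_sub_inv_le_log_of_pos (x := ((m : ℝ) + 1 + 1) / (m + 1)) (by positivity)
      rw [Real.log_div (by positivity) (by positivity), inv_div] at h2
      have h3 : ((m : ℝ) + 1 + 1) * (1 - (m + 1) / (m + 1 + 1)) = 1 := by field_simp; ring
      have h4 := mul_le_mul_of_nonneg_left h2 (by positivity : 0 ≤ (m : ℝ) + 1 + 1)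
      rw [h3] at h4
      rw [h1]
      push_cast
      nlinarith
  rcases n with _ | m
  · simp [polyLog]
  · refine (key m).trans ?_
    have : Real.log ((m : ℝ) + 1) ≤ Real.log ((m : ℝ) + 1 + 1) := by gcongr; linarith
    unfold polyLog
    push_cast
    linarith

variable {A : Type*} [Fintype A] [DecidableEq A] {n : ℕ}

lemma mul_entropy_freq {k : A → ℕ} (hk : ∑ a, k a = n) :
    n * entropy (freq n k) = n * Real.log n - ∑ a, k a * Real.log (k a) := by
  rcases Nat.eq_zero_or_pos n with rfl | hn
  · have : ∀ a, k a = 0 := by simpa using hk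
    simp [this]
  have hn' : (0 : ℝ) < n := by exact_mod_cast hn
  have h : ∀ a, n * Real.negMulLog (freq n k a) = k a * Real.log n - k a * Real.log (k a) := by
    intro a
    unfold freq Real.negMulLog
    rcases Nat.eq_zero_or_pos (k a) with h0 | h0
    · simp [h0]
    have h0' : (0 : ℝ) < k a := by exact_mod_cast h0
    rw [Real.log_div h0'.ne' hn'.ne']
    field_simp
    ring
  unfold entropy
  rw [mul_sum, sum_congr rfl fun a _ => h a, sum_sub_distrib, ← sum_mul, ← Nat.cast_sum, hk]

lemma log_card_typeClass {k : A → ℕ} (hk : ∑ a, k a = n) :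
    Real.log #(typeClass n k) =
      Real.log n.factorial - ∑ a, Real.log (k a).factorial := by
  have h0 : (#(typeClass n k) : ℝ) ≠ 0 := by
    exact_mod_cast (card_pos.2 (typeClass_nonempty hk)).ne'
  have hf : ∀ a, ((k a).factorial : ℝ) ≠ 0 := fun a => by exact_mod_cast (k a).factorial_ne_zero
  rw [← card_typeClass_mul_prod_factorial hk]
  push_cast
  rw [Real.log_mul h0 (prod_ne_zero_iff.2 fun a _ => hf a), Real.log_prod fun a _ => hf a]
  ring

lemma card_typeClass_le {k : A → ℕ} (hk : ∑ a, k a = n) :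
    (#(typeClass n k) : ℝ) ≤ Real.exp (n * entropy (freq n k) + polyLog n) := by
  have h0 : (0 : ℝ) < #(typeClass n k) := by exact_mod_cast card_pos.2 (typeClass_nonempty hk)
  rw [← Real.log_le_iff_le_exp h0, log_card_typeClass hk, mul_entropy_freq hk]
  have h1 := log_factorial_le n
  have h2 : ∑ a, ((k a : ℝ) * Real.log (k a) - k a) ≤ ∑ a, Real.log (k a).factorial :=
    sum_le_sum fun a _ => le_log_factorial _
  rw [sum_sub_distrib, ← Nat.cast_sum, hk] at h2
  linarith

lemma exp_le_card_typeClass {k : A → ℕ} (hk : ∑ a, k a = n) :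
    Real.exp (n * entropy (freq n k) - Fintype.card A * polyLog n) ≤ #(typeClass n k) := by
  have h0 : (0 : ℝ) < #(typeClass n k) := by exact_mod_cast card_pos.2 (typeClass_nonempty hk)
  rw [← Real.le_log_iff_exp_le h0, log_card_typeClass hk, mul_entropy_freq hk]
  have h1 := le_log_factorial n
  have h2 : ∑ a, Real.log (k a).factorial ≤
      ∑ a, ((k a : ℝ) * Real.log (k a) - k a + polyLog n) :=
    sum_le_sum fun a _ => (log_factorial_le _).trans (by
      have : k a ≤ n := hk ▸ single_le_sum (f := k) (fun _ _ => Nat.zero_le _) (mem_univ a)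
      linarith [polyLog_mono this])
  rw [sum_add_distrib, sum_sub_distrib, ← Nat.cast_sum, hk] at h2
  simp only [sum_const, card_univ, nsmul_eq_mul] at h2
  linarith

end Entropy

/-! ### Covering and packing of type classes -/

section Cover

open Finset

/-- Greedy covering: if every `x ∈ S` is related to at least a fraction `p` of `T`, then about
`log #S / p` elements of `T` are enough to cover `S`, because some element of `T` always covers at
least a fraction `p` of the part of `S` that is still uncovered. -/
lemma exists_cover {X Y : Type*} [DecidableEq Y] (S : Finset X) (T : Finset Y) (hT : T.Nonempty)
    (E : X → Y → Prop) [∀ x y, Decidable (E x y)] {p : ℝ} (hp : 0 < p)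
    (h : ∀ x ∈ S, p * #T ≤ #{y ∈ T | E x y}) :
    ∃ C ⊆ T, (∀ x ∈ S, ∃ y ∈ C, E x y) ∧ (#C : ℝ) ≤ Real.log #S / p + 1 := by
  rcases S.eq_empty_or_nonempty with rfl | hS
  · exact ⟨∅, by simp, by simp, by simp⟩
  have hT0 : (0 : ℝ) < #T := by exact_mod_cast card_pos.2 hT
  have hS0 : (0 : ℝ) < #S := by exact_mod_cast card_pos.2 hS
  have hp1 : p ≤ 1 := by
    obtain ⟨x, hx⟩ := hS
    have h1 : (#{y ∈ T | E x y} : ℝ) ≤ #T := by exact_mod_cast card_filter_le _ _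
    have := (h x hx).trans h1
    by_contra hc
    nlinarith
  have greedy : ∀ m : ℕ, ∃ C ⊆ T, #C ≤ m ∧
      (#{x ∈ S | ∀ y ∈ C, ¬ E x y} : ℝ) ≤ (1 - p) ^ m * #S := by
    intro m
    induction m with
    | zero => exact ⟨∅, by simp, by simp, by simp⟩
    | succ m ih =>
      obtain ⟨C, hCT, hCm, hC⟩ := ih
      set U := {x ∈ S | ∀ y ∈ C, ¬ E x y} with hU
      have hsum : ∑ _y ∈ T, p * (#U : ℝ) ≤ ∑ y ∈ T, (#{x ∈ U | E x y} : ℝ) := by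
        have h1 : ∑ y ∈ T, #{x ∈ U | E x y} = ∑ x ∈ U, #{y ∈ T | E x y} :=
          (sum_card_bipartiteAbove_eq_sum_card_bipartiteBelow (s := U) (t := T) E).symm
        have h2 : ∑ y ∈ T, (#{x ∈ U | E x y} : ℝ) = ∑ x ∈ U, (#{y ∈ T | E x y} : ℝ) := by
          exact_mod_cast h1
        rw [h2]
        refine le_trans (le_of_eq ?_) (sum_le_sum (f := fun _ => p * (#T : ℝ)) fun x hx =>
          h x (mem_filter.1 hx).1)
        simp only [sum_const, nsmul_eq_mul]
        ring
      obtain ⟨y, hyT, hy⟩ := exists_le_of_sum_le hT hsum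
      refine ⟨insert y C, insert_subset hyT hCT, (card_insert_le _ _).trans (by omega), ?_⟩
      have h3 : {x ∈ S | ∀ y' ∈ insert y C, ¬ E x y'} = {x ∈ U | ¬ E x y} := by
        ext x
        simp only [hU, mem_filter, mem_insert, forall_eq_or_imp]
        tauto
      have h4 := card_filter_add_card_filter_not (s := U) (fun x => E x y)
      have h5 : (#{x ∈ U | E x y} : ℝ) + #{x ∈ U | ¬ E x y} = #U := by exact_mod_cast h4
      rw [h3, pow_succ]
      have := mul_le_mul_of_nonneg_left hC (sub_nonneg.2 hp1)
      nlinarith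
  set m := ⌊Real.log #S / p⌋₊ + 1 with hm
  have hlog : 0 ≤ Real.log #S := Real.log_nonneg (by exact_mod_cast card_pos.2 hS)
  have hmlt : Real.log #S < p * m := by
    have : Real.log #S / p < m := by rw [hm]; push_cast; exact Nat.lt_floor_add_one _
    rwa [div_lt_iff₀' hp] at this
  obtain ⟨C, hCT, hCm, hC⟩ := greedy m
  refine ⟨C, hCT, ?_, ?_⟩
  · have h1 : (1 - p) ^ m * #S < (1 : ℝ) := by
      calc (1 - p) ^ m * #S ≤ Real.exp (-p) ^ m * #S := by
            gcongr
            linarith [Real.add_one_le_exp (-p)]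
        _ = Real.exp (Real.log #S - p * m) := by
            rw [← Real.exp_nat_mul, sub_eq_add_neg, Real.exp_add, Real.exp_log hS0, mul_comm]
            ring_nf
        _ < 1 := Real.exp_lt_one_iff.2 (by linarith)
    have h2 : #{x ∈ S | ∀ y ∈ C, ¬ E x y} = 0 := by
      have : (#{x ∈ S | ∀ y ∈ C, ¬ E x y} : ℝ) < 1 := hC.trans_lt h1
      have : #{x ∈ S | ∀ y ∈ C, ¬ E x y} < 1 := by exact_mod_cast this
      omega
    intro x hx
    by_contra! hc
    have : x ∈ ({x ∈ S | ∀ y ∈ C, ¬ E x y} : Finset X) := mem_filter.2 ⟨hx, hc⟩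
    rw [card_eq_zero.1 h2] at this
    simp at this
  · have h1 : (#C : ℝ) ≤ m := by exact_mod_cast hCm
    refine h1.trans ?_
    rw [hm]
    push_cast
    gcongr
    exact Nat.floor_le (by positivity)

end Cover

section Mass

open Finset

variable {A : Type*} {n : ℕ}

/-- The mass of a set of strings under the product weights `∏ i, w (x i)`. -/
def mass (w : A → ℝ) (S : Finset (Fin n → A)) : ℝ :=
  ∑ x ∈ S, ∏ i, w (x i)

lemma mass_nonneg {w : A → ℝ} (hw : ∀ a, 0 < w a) (S : Finset (Fin n → A)) : 0 ≤ mass w S :=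
  sum_nonneg fun _ _ => prod_nonneg fun _ _ => (hw _).le

lemma mass_mono {w : A → ℝ} (hw : ∀ a, 0 < w a) {S T : Finset (Fin n → A)} (h : S ⊆ T) :
    mass w S ≤ mass w T :=
  sum_le_sum_of_subset_of_nonneg h fun _ _ _ => prod_nonneg fun _ _ => (hw _).le

lemma mass_biUnion_le [DecidableEq A] {ι : Type*} {w : A → ℝ} (hw : ∀ a, 0 < w a) (s : Finset ι)
    (F : ι → Finset (Fin n → A)) : mass w (s.biUnion F) ≤ ∑ i ∈ s, mass w (F i) := by
  classical
  induction s using Finset.induction_on with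
  | empty => simp [mass]
  | insert i s hi ih =>
    rw [biUnion_insert, sum_insert hi]
    have h1 : mass w (F i ∪ s.biUnion F) + mass w (F i ∩ s.biUnion F) =
      mass w (F i) + mass w (s.biUnion F) := sum_union_inter
    linarith [mass_nonneg hw (F i ∩ s.biUnion F)]

variable [Fintype A] [DecidableEq A]

lemma prod_eq_exp_of_mem_typeClass {w : A → ℝ} (hw : ∀ a, 0 < w a) {k : A → ℕ} {x : Fin n → A}
    (hx : x ∈ typeClass n k) : ∏ i, w (x i) = Real.exp (∑ a, k a * Real.log (w a)) := by
  rw [← mem_typeClass.1 hx, ← sum_comp_eq_sum_letterCount x fun a => Real.log (w a), Real.exp_sum]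
  exact prod_congr rfl fun i _ => (Real.exp_log (hw _)).symm

lemma mass_eq_of_subset_typeClass {w : A → ℝ} (hw : ∀ a, 0 < w a) {k : A → ℕ}
    {S : Finset (Fin n → A)} (hS : S ⊆ typeClass n k) :
    mass w S = #S * Real.exp (∑ a, k a * Real.log (w a)) := by
  unfold mass
  rw [sum_congr rfl fun x hx => prod_eq_exp_of_mem_typeClass hw (hS hx), sum_const, nsmul_eq_mul]

open scoped Classical in
/-- The strings that are not within distortion `D` of `C`. -/
noncomputable def uncovered (ρ : A → A → ℝ) (D : ℝ) (n : ℕ) (C : Finset (Fin n → A)) :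
    Finset (Fin n → A) :=
  {x | ¬ ∃ y ∈ C, ∑ i, ρ (x i) (y i) ≤ n * D}

lemma mem_uncovered {ρ : A → A → ℝ} {D : ℝ} {n : ℕ} {C : Finset (Fin n → A)} {x : Fin n → A} :
    x ∈ uncovered ρ D n C ↔ ¬ ∃ y ∈ C, ∑ i, ρ (x i) (y i) ≤ n * D := by
  simp [uncovered]

end Mass

section TypeBounds

open Finset

variable {A : Type*} [Fintype A] [DecidableEq A] {n : ℕ}

/-- The single-letter objective `H(X) + H(Y) - H(X, Y) + E[ln w(Y)] = I(X; Y) + E[ln w(Y)]` of the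
pair `(X, Y)` with joint weights `p`, in the form of a continuous function of `p`. -/
noncomputable def cost (w : A → ℝ) (p : A × A → ℝ) : ℝ :=
  entropy (marginal Prod.fst p) + entropy (marginal Prod.snd p) - entropy p +
    ∑ b, marginal Prod.snd p b * Real.log (w b)

/-- The relative entropy `∑ q ln (q / w)`, in the form of a continuous function of `q`. -/
noncomputable def relEntropy (w q : A → ℝ) : ℝ :=
  -entropy q - ∑ a, q a * Real.log (w a)

lemma freq_marginal {B : Type*} [DecidableEq B] (φ : A → B) (κ : A → ℕ) :
    freq n (marginal φ κ) = marginal φ (freq n κ) := by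
  ext b
  simp [freq, marginal, sum_div]

lemma mul_sum_freq_mul {k : A → ℕ} (hn : 0 < n) (g : A → ℝ) :
    n * ∑ a, freq n k a * g a = ∑ a, k a * g a := by
  have hn' : (n : ℝ) ≠ 0 := by exact_mod_cast hn.ne'
  rw [mul_sum]
  refine sum_congr rfl fun a _ => ?_
  unfold freq
  field_simp

lemma mul_cost_freq (w : A → ℝ) (κ : A × A → ℕ) (hn : 0 < n) :
    n * cost w (freq n κ) = n * entropy (freq n (marginal Prod.fst κ)) +
      n * entropy (freq n (marginal Prod.snd κ)) - n * entropy (freq n κ) +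
      ∑ b, (marginal Prod.snd κ b : ℕ) * Real.log (w b) := by
  unfold cost
  rw [← freq_marginal, ← freq_marginal, ← mul_sum_freq_mul hn]
  ring

lemma mass_typeClass_le {w : A → ℝ} (hw : ∀ a, 0 < w a) {k : A → ℕ} (hk : ∑ a, k a = n)
    (hn : 0 < n) :
    mass w (typeClass n k) ≤ Real.exp (-(n * relEntropy w (freq n k)) + polyLog n) := by
  rw [mass_eq_of_subset_typeClass hw subset_rfl]
  refine (mul_le_mul_of_nonneg_right (card_typeClass_le hk) (Real.exp_pos _).le).trans ?_
  rw [← Real.exp_add, ← mul_sum_freq_mul hn]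
  apply le_of_eq
  unfold relEntropy
  ring_nf

lemma exp_le_mass_typeClass {w : A → ℝ} (hw : ∀ a, 0 < w a) {k : A → ℕ} (hk : ∑ a, k a = n)
    (hn : 0 < n) :
    Real.exp (-(n * relEntropy w (freq n k)) - Fintype.card A * polyLog n) ≤
      mass w (typeClass n k) := by
  rw [mass_eq_of_subset_typeClass hw subset_rfl]
  refine le_trans ?_
    (mul_le_mul_of_nonneg_right (exp_le_card_typeClass hk) (Real.exp_pos _).le)
  rw [← Real.exp_add, ← mul_sum_freq_mul hn]
  apply le_of_eq
  unfold relEntropy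
  ring_nf

/-- A set of strings of small mass can only cover a small part of a type class: the strings `y` of
a given type that have joint type `κ` with some string of the type class number at most
`mass w C * exp (-∑ κ_Y ln w)`, and each of them reaches only `exp (n H(X | Y))` strings. -/
lemma card_covered_le {w : A → ℝ} (hw : ∀ a, 0 < w a) {ρ : A → A → ℝ} {D c : ℝ} {k : A → ℕ}
    (hk : ∑ a, k a = n) (hn : 0 < n) (C : Finset (Fin n → A))
    (hc : ∀ κ : A × A → ℕ, ∑ z, κ z = n → marginal Prod.fst κ = k →
      ∑ z, (κ z : ℝ) * ρ z.1 z.2 ≤ n * D → c ≤ cost w (freq n κ)) :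
    (#{x ∈ typeClass n k | ∃ y ∈ C, ∑ i, ρ (x i) (y i) ≤ n * D} : ℝ) ≤
      Real.exp ((Fintype.card (A × A) + 2 * Fintype.card A + 1 : ℕ) * polyLog n - n * c) *
        mass w C * #(typeClass n k) := by
  classical
  set L := polyLog n
  let K : Finset (A × A → ℕ) := {κ ∈ piAntidiag univ n |
    marginal Prod.fst κ = k ∧ ∑ z, (κ z : ℝ) * ρ z.1 z.2 ≤ n * D}
  let G : (A × A → ℕ) → Finset (Fin n → A) := fun κ => C ∩ typeClass n (marginal Prod.snd κ)
  let F : (A × A → ℕ) → (Fin n → A) → Finset (Fin n → A) := fun κ y =>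
    {x | (fun i => (x i, y i)) ∈ typeClass n κ}
  have hsub : ({x ∈ typeClass n k | ∃ y ∈ C, ∑ i, ρ (x i) (y i) ≤ n * D} : Finset _) ⊆
      K.biUnion fun κ => (G κ).biUnion (F κ) := by
    intro x hx
    obtain ⟨hxk, y, hyC, hy⟩ := mem_filter.1 hx
    let z : Fin n → A × A := fun i => (x i, y i)
    refine mem_biUnion.2 ⟨letterCount z, ?_, mem_biUnion.2 ⟨y, ?_, ?_⟩⟩
    · simp only [K, mem_filter, mem_piAntidiag, mem_univ, implies_true, and_true]
      refine ⟨sum_letterCount z, ?_, ?_⟩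
      · rw [marginal_letterCount]; exact mem_typeClass.1 hxk
      · rwa [← sum_comp_eq_sum_letterCount z fun z => ρ z.1 z.2]
    · refine mem_inter.2 ⟨hyC, mem_typeClass.2 ?_⟩
      rw [marginal_letterCount]; rfl
    · simp only [F, mem_filter, mem_univ, true_and, mem_typeClass]; rfl
  have hT0 : (0 : ℝ) < #(typeClass n k) := by exact_mod_cast card_pos.2 (typeClass_nonempty hk)
  have hF : ∀ κ ∈ K, ((#((G κ).biUnion (F κ)) : ℕ) : ℝ) ≤
      Real.exp ((2 * Fintype.card A + 1 : ℕ) * L - n * c) * mass w C * #(typeClass n k) := by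
    intro κ hκ
    simp only [K, mem_filter, mem_piAntidiag, mem_univ, implies_true, and_true] at hκ
    obtain ⟨hκn, hκk, hκD⟩ := hκ
    have hYn : ∑ b, marginal Prod.snd κ b = n := by rw [sum_marginal, hκn]
    set TY := typeClass n (marginal Prod.snd κ) with hTY
    have hTY0 : (0 : ℝ) < #TY := by exact_mod_cast card_pos.2 (typeClass_nonempty hYn)
    have h1 : ∀ y ∈ G κ, (#(F κ y) : ℝ) ≤ #(typeClass n κ) / #TY := by
      intro y hy
      have hyT := (mem_inter.1 hy).2
      rw [le_div_iff₀ hTY0]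
      have h2 := card_fiber_mul_card_typeClass Prod.snd κ hyT
      have h3 : #(F κ y) ≤ #{z ∈ typeClass n κ | Prod.snd ∘ z = y} := by
        refine card_le_card_of_injOn (fun x i => (x i, y i)) ?_ ?_
        · intro x hx
          have hx : (fun i => (x i, y i)) ∈ typeClass n κ := by simpa [F] using hx
          simp only [coe_filter, Set.mem_ofPred_eq]
          exact ⟨hx, rfl⟩
        · intro x _ x' _ h
          funext i
          exact congrArg Prod.fst (congrFun h i)
      rw [← h2]
      push_cast
      gcongr
    have h4 : (#((G κ).biUnion (F κ)) : ℝ) ≤ #(G κ) * (#(typeClass n κ) / #TY) := by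
      have : #((G κ).biUnion (F κ)) ≤ ∑ y ∈ G κ, #(F κ y) := card_biUnion_le
      calc (#((G κ).biUnion (F κ)) : ℝ) ≤ ∑ y ∈ G κ, (#(F κ y) : ℝ) := by exact_mod_cast this
        _ ≤ ∑ y ∈ G κ, (#(typeClass n κ) / #TY : ℝ) := sum_le_sum h1
        _ = _ := by rw [sum_const, nsmul_eq_mul]
    set s := ∑ b, (marginal Prod.snd κ b : ℕ) * Real.log (w b)
    have h5 : (#(G κ) : ℝ) ≤ mass w C * Real.exp (-s) := by
      have h6 : mass w (G κ) ≤ mass w C := mass_mono hw inter_subset_left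
      rw [mass_eq_of_subset_typeClass hw (k := marginal Prod.snd κ) inter_subset_right] at h6
      rw [Real.exp_neg, ← div_eq_mul_inv, le_div_iff₀ (Real.exp_pos _)]
      exact h6
    have h7 : (#(typeClass n κ) : ℝ) / #TY ≤
        Real.exp (n * entropy (freq n κ) + L -
          (n * entropy (freq n (marginal Prod.snd κ)) - Fintype.card A * L)) := by
      rw [Real.exp_sub]
      gcongr
      · exact card_typeClass_le hκn
      · exact exp_le_card_typeClass hYn
    have h8 := exp_le_card_typeClass hk
    have h9 := mul_cost_freq w κ hn
    rw [hκk] at h9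
    have h10 : (n : ℝ) * c ≤ n * cost w (freq n κ) := by
      gcongr; exact hc κ hκn hκk hκD
    have hm := mass_nonneg hw C
    calc (#((G κ).biUnion (F κ)) : ℝ) ≤ #(G κ) * (#(typeClass n κ) / #TY) := h4
      _ ≤ (mass w C * Real.exp (-s)) * Real.exp (n * entropy (freq n κ) + L -
          (n * entropy (freq n (marginal Prod.snd κ)) - Fintype.card A * L)) := by gcongr
      _ = mass w C * Real.exp (-s + (n * entropy (freq n κ) + L -
          (n * entropy (freq n (marginal Prod.snd κ)) - Fintype.card A * L))) := by
          rw [mul_assoc, ← Real.exp_add]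
      _ ≤ mass w C * Real.exp (((2 * Fintype.card A + 1 : ℕ) * L - n * c) +
            (n * entropy (freq n k) - Fintype.card A * L)) := by
          refine mul_le_mul_of_nonneg_left (Real.exp_le_exp.2 ?_) hm
          push_cast
          linarith
      _ = Real.exp ((2 * Fintype.card A + 1 : ℕ) * L - n * c) * mass w C *
            Real.exp (n * entropy (freq n k) - Fintype.card A * L) := by
          rw [Real.exp_add]; ring
      _ ≤ _ := by gcongr
  have hK : (#K : ℝ) ≤ Real.exp (Fintype.card (A × A) * L) := by
    refine le_trans ?_ (add_one_pow_le_exp_polyLog n _)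
    exact_mod_cast (card_filter_le _ _).trans (card_piAntidiag_le (A × A) n)
  have hm := mass_nonneg hw C
  calc (#{x ∈ typeClass n k | ∃ y ∈ C, ∑ i, ρ (x i) (y i) ≤ n * D} : ℝ)
      ≤ ∑ κ ∈ K, ((#((G κ).biUnion (F κ)) : ℕ) : ℝ) := by
        exact_mod_cast (card_le_card hsub).trans card_biUnion_le
    _ ≤ ∑ κ ∈ K, _ := sum_le_sum hF
    _ = #K * (Real.exp ((2 * Fintype.card A + 1 : ℕ) * L - n * c) * mass w C *
        #(typeClass n k)) := by rw [sum_const, nsmul_eq_mul]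
    _ ≤ Real.exp (Fintype.card (A × A) * L) * (Real.exp ((2 * Fintype.card A + 1 : ℕ) * L - n * c) *
        mass w C * #(typeClass n k)) := by gcongr
    _ = _ := by
        rw [← mul_assoc, ← mul_assoc, ← Real.exp_add]
        push_cast
        ring_nf

/-- A type class can be covered by a set of strings whose mass is, up to polynomial factors,
`exp (n * cost)` for any joint type `κ` whose first marginal is the given type. -/
lemma exists_cover_typeClass {w : A → ℝ} (hw : ∀ a, 0 < w a) {κ : A × A → ℕ}
    (hκ : ∑ z, κ z = n) (hn : 0 < n) :
    ∃ C : Finset (Fin n → A), (∀ x ∈ typeClass n (marginal Prod.fst κ), ∃ y ∈ C,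
        (fun i => (x i, y i)) ∈ typeClass n κ) ∧
      mass w C ≤ Real.exp (n * cost w (freq n κ) +
        (Fintype.card (A × A) + Fintype.card A + 3 : ℕ) * polyLog n) := by
  classical
  set L := polyLog n with hL
  have hXn : ∑ b, marginal Prod.fst κ b = n := by rw [sum_marginal, hκ]
  have hYn : ∑ b, marginal Prod.snd κ b = n := by rw [sum_marginal, hκ]
  set TX := typeClass n (marginal Prod.fst κ) with hTX
  set TY := typeClass n (marginal Prod.snd κ) with hTY
  have hTXne : TX.Nonempty := typeClass_nonempty hXn
  have hTYne : TY.Nonempty := typeClass_nonempty hYn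
  have hTX0 : (0 : ℝ) < #TX := by exact_mod_cast card_pos.2 hTXne
  have hTY0 : (0 : ℝ) < #TY := by exact_mod_cast card_pos.2 hTYne
  have hT0 : (0 : ℝ) < #(typeClass n κ) := by exact_mod_cast card_pos.2 (typeClass_nonempty hκ)
  -- the fraction of the strings of `TY` that have joint type `κ` with a given string of `TX`
  set p : ℝ := #(typeClass n κ) / (#TX * #TY) with hp
  have hp0 : 0 < p := by positivity
  have hdeg : ∀ x ∈ TX, p * #TY ≤ #{y ∈ TY | (fun i => (x i, y i)) ∈ typeClass n κ} := by
    intro x hx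
    have h1 := card_fiber_mul_card_typeClass Prod.fst κ hx
    have h2 : #{z ∈ typeClass n κ | Prod.fst ∘ z = x} ≤
        #{y ∈ TY | (fun i => (x i, y i)) ∈ typeClass n κ} := by
      refine card_le_card_of_injOn (fun z => Prod.snd ∘ z) ?_ ?_
      · intro z hz
        simp only [coe_filter, Set.mem_ofPred_eq] at hz ⊢
        obtain ⟨hz, rfl⟩ := hz
        refine ⟨?_, hz⟩
        rw [hTY, mem_typeClass, ← marginal_letterCount, mem_typeClass.1 hz]
      · intro z hz z' hz' h
        simp only [coe_filter, Set.mem_ofPred_eq] at hz hz'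
        funext i
        exact Prod.ext (congrFun (hz.2.trans hz'.2.symm) i) (congrFun h i)
    have h3 : p * #TY = #{z ∈ typeClass n κ | Prod.fst ∘ z = x} := by
      rw [hp, ← h1, Nat.cast_mul, ← hTX]
      field_simp
    rw [h3]
    exact_mod_cast h2
  obtain ⟨C, hCT, hcov, hcard⟩ := exists_cover TX TY hTYne
    (fun x y => (fun i => (x i, y i)) ∈ typeClass n κ) hp0 hdeg
  refine ⟨C, hcov, ?_⟩
  have hp1 : p ≤ 1 := by
    obtain ⟨x, hx⟩ := hTXne
    have h1 : (#{y ∈ TY | (fun i => (x i, y i)) ∈ typeClass n κ} : ℝ) ≤ #TY := by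
      exact_mod_cast card_filter_le _ _
    have := (hdeg x hx).trans h1
    by_contra hc
    nlinarith
  have hinv : 1 / p ≤ Real.exp ((n * entropy (freq n (marginal Prod.fst κ)) + L) +
      (n * entropy (freq n (marginal Prod.snd κ)) + L) -
      (n * entropy (freq n κ) - Fintype.card (A × A) * L)) := by
    rw [hp, one_div_div, Real.exp_sub, Real.exp_add]
    gcongr
    · exact card_typeClass_le hXn
    · exact card_typeClass_le hYn
    · exact exp_le_card_typeClass hκ
  have hlog : Real.log #TX ≤ n * Fintype.card A := by
    have h1 : #TX ≤ Fintype.card A ^ n := by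
      simpa using card_le_univ TX
    calc Real.log #TX ≤ Real.log ((Fintype.card A : ℝ) ^ n) := by
          gcongr
          exact_mod_cast h1
      _ = n * Real.log (Fintype.card A) := Real.log_pow _ _
      _ ≤ n * Fintype.card A := by gcongr; exact Real.log_le_self (Nat.cast_nonneg _)
  have hC : (#C : ℝ) ≤ Real.exp ((Fintype.card A + 1 : ℕ) * L) * (1 / p) := by
    have h1 : (1 : ℝ) ≤ 1 / p := by rw [one_div]; exact one_le_inv_iff₀.2 ⟨hp0, hp1⟩
    have h2 : (n : ℝ) + 1 ≤ Real.exp L := by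
      simpa using add_one_pow_le_exp_polyLog n 1
    have h3 : (Fintype.card A : ℝ) + 1 ≤ Real.exp (Fintype.card A * L) := by
      refine (Real.add_one_le_exp _).trans (Real.exp_le_exp.2 ?_)
      exact le_mul_of_one_le_right (Nat.cast_nonneg _) (one_le_polyLog n)
    calc (#C : ℝ) ≤ Real.log #TX / p + 1 := hcard
      _ ≤ (n * Fintype.card A) / p + 1 / p := by gcongr
      _ = (n * Fintype.card A + 1) * (1 / p) := by ring
      _ ≤ ((Fintype.card A + 1) * (n + 1)) * (1 / p) := by
          gcongr
          nlinarith [Nat.cast_nonneg (α := ℝ) n, Nat.cast_nonneg (α := ℝ) (Fintype.card A)]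
      _ ≤ (Real.exp (Fintype.card A * L) * Real.exp L) * (1 / p) := by gcongr
      _ = _ := by rw [← Real.exp_add]; push_cast; ring_nf
  rw [mass_eq_of_subset_typeClass hw hCT]
  refine (mul_le_mul_of_nonneg_right (hC.trans
    (mul_le_mul_of_nonneg_left hinv (Real.exp_pos _).le)) (Real.exp_pos _).le).trans ?_
  rw [← Real.exp_add, ← Real.exp_add, mul_cost_freq w κ hn]
  apply le_of_eq
  push_cast
  ring_nf

end TypeBounds

/-! ### Continuity and rounding of the single-letter quantities -/

section SingleLetter

open Finset

variable {A : Type*} [Fintype A] [DecidableEq A] {n : ℕ}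

lemma continuous_entropy : Continuous (entropy : (A → ℝ) → ℝ) := by
  unfold entropy; fun_prop

lemma continuous_marginal {B : Type*} [DecidableEq B] (φ : A → B) :
    Continuous (marginal φ : (A → ℝ) → B → ℝ) := by
  unfold marginal; fun_prop

lemma continuous_cost (w : A → ℝ) : Continuous (cost w) := by
  have h1 := continuous_marginal (Prod.fst : A × A → A)
  have h2 := continuous_marginal (Prod.snd : A × A → A)
  have h3 : ∀ b, Continuous fun p : A × A → ℝ => marginal Prod.snd p b :=
    fun b => (continuous_apply b).comp h2
  have h4 := (continuous_entropy (A := A)).comp h1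
  have h5 := (continuous_entropy (A := A)).comp h2
  exact ((h4.add h5).sub continuous_entropy).add
    (continuous_finsetSum _ fun b _ => (h3 b).mul continuous_const)

lemma continuous_relEntropy (w : A → ℝ) : Continuous (relEntropy w) := by
  unfold relEntropy
  have := continuous_entropy (A := A)
  fun_prop

lemma marginal_fst {M : Type*} [AddCommMonoid M] (p : A × A → M) (a : A) :
    marginal Prod.fst p a = ∑ b, p (a, b) := by
  unfold marginal
  rw [sum_filter, Fintype.sum_prod_type, sum_comm]
  simp

lemma freq_mem_stdSimplex {k : A → ℕ} (hk : ∑ a, k a = n) (hn : 0 < n) :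
    freq n k ∈ stdSimplex ℝ A := by
  refine ⟨fun a => by unfold freq; positivity, ?_⟩
  unfold freq
  rw [← sum_div, ← Nat.cast_sum, hk]
  exact div_self (by exact_mod_cast hn.ne')

/-- The weights of the joint distributions of `(X, Y)` with `X` distributed as `q` and
`E[ρ(X, Y)] ≤ D`. -/
def couplings (ρ : A → A → ℝ) (D : ℝ) (q : A → ℝ) : Set (A × A → ℝ) :=
  {p | p ∈ stdSimplex ℝ (A × A) ∧ marginal Prod.fst p = q ∧ ∑ z, p z * ρ z.1 z.2 ≤ D}

/-- Lower semicontinuity of the rate function in the distribution of `X`, a consequence of the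
compactness of the set of all joint distributions. -/
lemma eventually_forall_lt_cost (w : A → ℝ) {ρ : A → A → ℝ} {D c c' : ℝ} {q : A → ℝ}
    (hcc : c < c') (hq : ∀ p ∈ couplings ρ D q, c' ≤ cost w p) :
    ∀ᶠ q' in 𝓝 q, ∀ p ∈ couplings ρ D q', c < cost w p := by
  have hcl : IsClosed {p : A × A → ℝ | ∑ z, p z * ρ z.1 z.2 ≤ D ∧ cost w p ≤ c} := by
    have h : Continuous fun p : A × A → ℝ => ∑ z, p z * ρ z.1 z.2 := by fun_prop
    exact (isClosed_le h continuous_const).inter (isClosed_le (continuous_cost w) continuous_const)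
  have hK := ((isCompact_stdSimplex ℝ (A × A)).inter_right hcl).image
    (continuous_marginal (Prod.fst : A × A → A))
  have hmem : q ∈ ((marginal Prod.fst : (A × A → ℝ) → A → ℝ) '' (stdSimplex ℝ (A × A) ∩
      {p | ∑ z, p z * ρ z.1 z.2 ≤ D ∧ cost w p ≤ c}))ᶜ := by
    rintro ⟨p, ⟨hp, hpD, hpc⟩, hpq⟩
    linarith [hq p ⟨hp, hpq, hpD⟩]
  filter_upwards [hK.isClosed.isOpen_compl.mem_nhds hmem] with q' hq' p hp
  by_contra hc
  exact hq' ⟨p, ⟨hp.1, hp.2.2, not_lt.1 hc⟩, hp.2.1⟩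

/-- Upper semicontinuity of the rate function at a distribution `w` of full support. A coupling for
`w` becomes one for a nearby `q` by scaling down the rows with too much mass and sending the
missing mass of each row to a letter at distortion zero, which does not increase the distortion. -/
lemma eventually_exists_cost_lt {w : A → ℝ} (hw : ∀ a, 0 < w a) {ρ : A → A → ℝ}
    (hρ : ∀ a b, 0 ≤ ρ a b) (hρ0 : ∀ a, ∃ b, ρ a b = 0) {D c : ℝ} {p : A × A → ℝ}
    (hp : p ∈ couplings ρ D w) (hpc : cost w p < c) :
    ∀ᶠ q in 𝓝[stdSimplex ℝ A] w, ∃ p' ∈ couplings ρ D q, cost w p' < c := by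
  choose b₀ hb₀ using hρ0
  let m : (A → ℝ) → A → ℝ := fun q a => min 1 (q a / w a)
  let F : (A → ℝ) → A × A → ℝ := fun q z =>
    m q z.1 * p z + if z.2 = b₀ z.1 then q z.1 - m q z.1 * w z.1 else 0
  have hm1 : ∀ q a, m q a ≤ 1 := fun q a => min_le_left _ _
  have hmq : ∀ q a, m q a * w a ≤ q a := fun q a => by
    have : m q a ≤ q a / w a := min_le_right _ _
    rwa [le_div_iff₀ (hw a)] at this
  have hFc : Continuous F := by
    refine continuous_pi fun z => ?_
    have : Continuous fun q => m q z.1 :=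
      continuous_const.min ((continuous_apply z.1).div_const _)
    by_cases h : z.2 = b₀ z.1 <;> simp only [F, h, if_true, if_false] <;> fun_prop
  have hFw : F w = p := by
    ext z
    have : m w z.1 = 1 := by simp [m, div_self (hw z.1).ne']
    simp [F, this]
  have hrow : ∀ q a, ∑ b, F q (a, b) = q a := by
    intro q a
    have h1 : ∑ b, p (a, b) = w a := by
      rw [← hp.2.1, marginal_fst]
    simp only [F]
    rw [sum_add_distrib, ← mul_sum, h1]
    simp
  have hev : ∀ᶠ q in 𝓝 w, cost w (F q) < c := by
    have : Continuous fun q => cost w (F q) := (continuous_cost w).comp hFc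
    exact this.continuousAt.eventually_lt continuousAt_const (by simpa [hFw] using hpc)
  filter_upwards [nhdsWithin_le_nhds hev, self_mem_nhdsWithin] with q hq hqs
  have hm0 : ∀ a, 0 ≤ m q a := fun a => le_min zero_le_one (div_nonneg (hqs.1 a) (hw a).le)
  have hF0 : ∀ z, 0 ≤ F q z := by
    intro z
    have h1 := mul_nonneg (hm0 z.1) (hp.1.1 z)
    have h2 := hmq q z.1
    simp only [F]
    split_ifs <;> linarith
  refine ⟨F q, ⟨⟨hF0, ?_⟩, ?_, ?_⟩, hq⟩
  · rw [Fintype.sum_prod_type, sum_congr rfl fun a _ => hrow q a, hqs.2]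
  · ext a
    rw [marginal_fst, hrow q a]
  · refine (sum_le_sum fun z _ => ?_).trans hp.2.2
    by_cases h : z.2 = b₀ z.1
    · rw [h, hb₀]; simp
    · simp only [F, h, if_false, add_zero]
      have h1 := mul_nonneg (hp.1.1 z) (hρ z.1 z.2)
      nlinarith [hm1 q z.1]

lemma relEntropy_pos {w q : A → ℝ} (hw : ∀ a, 0 < w a) (hws : w ∈ stdSimplex ℝ A)
    (hq : q ∈ stdSimplex ℝ A) (hne : q ≠ w) : 0 < relEntropy w q := by
  have key : ∀ a, q a ≠ w a → Real.negMulLog (q a) + q a * Real.log (w a) < w a - q a := by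
    intro a ha
    rcases (hq.1 a).eq_or_lt with h0 | h0
    · simp [← h0, hw a]
    have h1 := Real.log_lt_sub_one_of_pos (div_pos (hw a) h0)
      (fun h => ha ((div_eq_one_iff_eq h0.ne').1 h).symm)
    rw [Real.log_div (hw a).ne' h0.ne'] at h1
    have h2 := mul_lt_mul_of_pos_left h1 h0
    have h3 : q a * (w a / q a - 1) = w a - q a := by field_simp
    rw [h3] at h2
    unfold Real.negMulLog
    linarith
  have key' : ∀ a, Real.negMulLog (q a) + q a * Real.log (w a) ≤ w a - q a := by
    intro a
    by_cases h : q a = w a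
    · rw [h]; unfold Real.negMulLog; linarith
    · exact (key a h).le
  obtain ⟨a, ha⟩ := Function.ne_iff.1 hne
  have hlt := sum_lt_sum (s := univ) (fun a _ => key' a) ⟨a, mem_univ _, key a ha⟩
  rw [sum_add_distrib, sum_sub_distrib, hq.2, hws.2] at hlt
  unfold relEntropy entropy
  linarith

lemma exists_pos_le_relEntropy {w : A → ℝ} (hw : ∀ a, 0 < w a) (hws : w ∈ stdSimplex ℝ A)
    {S : Set (A → ℝ)} (hS : S ∈ 𝓝[stdSimplex ℝ A] w) :
    ∃ δ > 0, ∀ q ∈ stdSimplex ℝ A, q ∉ S → δ ≤ relEntropy w q := by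
  obtain ⟨O, hO, hwO, hOS⟩ := mem_nhdsWithin.1 hS
  have hK := (isCompact_stdSimplex ℝ A).diff hO
  rcases (stdSimplex ℝ A \ O).eq_empty_or_nonempty with he | hne
  · refine ⟨1, one_pos, fun q hq hqS => ?_⟩
    have : q ∈ stdSimplex ℝ A \ O := ⟨hq, fun h => hqS (hOS ⟨h, hq⟩)⟩
    simp [he] at this
  · obtain ⟨q₀, hq₀, hmin⟩ := hK.exists_isMinOn hne (continuous_relEntropy w).continuousOn
    refine ⟨relEntropy w q₀, relEntropy_pos hw hws hq₀.1 fun h => hq₀.2 (h ▸ hwO),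
      fun q hq hqS => ?_⟩
    exact hmin ⟨hq, fun h => hqS (hOS ⟨h, hq⟩)⟩

/-- Rounding of nonnegative reals with an integer sum to integers with the same sum: all entries but
one are rounded down, and the entry `s₀` takes what is left. -/
lemma exists_round {S : Type*} [Fintype S] [DecidableEq S] {t : S → ℝ} (ht : ∀ s, 0 ≤ t s)
    (s₀ : S) {N : ℕ} (hN : ∑ s, t s = N) :
    ∃ k : S → ℕ, ∑ s, k s = N ∧ (∀ s ≠ s₀, (k s : ℝ) ≤ t s) ∧
      ∀ s, |(k s : ℝ) - t s| ≤ Fintype.card S := by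
  have hfl : ∀ s, (⌊t s⌋₊ : ℝ) ≤ t s := fun s => Nat.floor_le (ht s)
  have hfl' : ∀ s, t s - 1 ≤ ⌊t s⌋₊ := fun s => (Nat.sub_one_lt_floor _).le
  have hcard : (1 : ℝ) ≤ Fintype.card S := by
    exact_mod_cast Fintype.card_pos_iff.2 ⟨s₀⟩
  set R := ∑ s ∈ univ.erase s₀, ⌊t s⌋₊ with hR
  have hsplit : ∑ s ∈ univ.erase s₀, t s + t s₀ = N := by
    rw [sum_erase_add _ _ (mem_univ _), hN]
  have hR1 : (R : ℝ) ≤ ∑ s ∈ univ.erase s₀, t s := by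
    rw [hR]; push_cast; exact sum_le_sum fun s _ => hfl s
  have hR2 : ∑ s ∈ univ.erase s₀, t s - Fintype.card S ≤ R := by
    have h1 : ∑ s ∈ univ.erase s₀, (t s - 1) ≤ (R : ℝ) := by
      rw [hR]; push_cast; exact sum_le_sum fun s _ => hfl' s
    rw [sum_sub_distrib] at h1
    have h2 : (#(univ.erase s₀) : ℝ) ≤ Fintype.card S := by exact_mod_cast card_le_univ _
    simp only [sum_const, nsmul_eq_mul, mul_one] at h1
    linarith
  have hRN : R ≤ N := by
    have : (R : ℝ) ≤ N := by linarith [ht s₀]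
    exact_mod_cast this
  refine ⟨fun s => if s = s₀ then N - R else ⌊t s⌋₊, ?_, ?_, ?_⟩
  · rw [← sum_erase_add _ _ (mem_univ s₀), sum_congr rfl (g := fun s => ⌊t s⌋₊)
      fun s hs => if_neg (ne_of_mem_erase hs)]
    simp only [if_true]
    omega
  · intro s hs
    simp only [if_neg hs]
    exact hfl s
  · intro s
    by_cases hs : s = s₀
    · subst hs
      simp only [if_true]
      rw [Nat.cast_sub hRN, abs_le]
      constructor <;> linarith
    · simp only [if_neg hs]
      rw [abs_le]
      constructor <;> linarith [hfl s, hfl' s]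

lemma exists_freq_near [Nonempty A] {q : A → ℝ} (hq : q ∈ stdSimplex ℝ A) (hn : 0 < n) :
    ∃ k : A → ℕ, ∑ a, k a = n ∧ dist (freq n k) q ≤ Fintype.card A / n := by
  have hn' : (0 : ℝ) < n := by exact_mod_cast hn
  obtain ⟨k, hk, -, hkq⟩ := exists_round (t := fun a => n * q a)
    (fun a => mul_nonneg hn'.le (hq.1 a)) (Classical.arbitrary A) (N := n)
    (by rw [← mul_sum, hq.2, mul_one])
  refine ⟨k, hk, (dist_pi_le_iff (by positivity)).2 fun a => ?_⟩
  rw [Real.dist_eq, le_div_iff₀ hn']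
  refine le_trans (le_of_eq ?_) (hkq a)
  rw [show (k a : ℝ) - n * q a = (freq n k a - q a) * n by unfold freq; field_simp, abs_mul,
    abs_of_pos hn']

/-- Rounding of a coupling to a joint type with a prescribed first marginal. In each row what is
left over goes to a letter at distortion zero, so that the distortion does not increase. -/
lemma exists_jointType_near {ρ : A → A → ℝ} (hρ : ∀ a b, 0 ≤ ρ a b)
    (hρ0 : ∀ a, ∃ b, ρ a b = 0) {D : ℝ} {k : A → ℕ} (hk : ∑ a, k a = n) (hn : 0 < n)
    {p : A × A → ℝ} (hp : p ∈ couplings ρ D (freq n k)) :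
    ∃ κ : A × A → ℕ, ∑ z, κ z = n ∧ marginal Prod.fst κ = k ∧
      ∑ z, (κ z : ℝ) * ρ z.1 z.2 ≤ n * D ∧ dist (freq n κ) p ≤ Fintype.card A / n := by
  have hn' : (0 : ℝ) < n := by exact_mod_cast hn
  choose b₀ hb₀ using hρ0
  have hround := fun a => exists_round (t := fun b => n * p (a, b))
    (fun b => mul_nonneg hn'.le (hp.1.1 _)) (b₀ a) (N := k a) (by
      rw [← mul_sum, ← marginal_fst, hp.2.1]
      unfold freq
      field_simp)
  choose κ hκ hκle hκp using hround
  have hmarg : marginal Prod.fst (fun z : A × A => κ z.1 z.2) = k := by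
    ext a
    rw [marginal_fst]
    exact hκ a
  refine ⟨fun z => κ z.1 z.2, ?_, hmarg, ?_, (dist_pi_le_iff (by positivity)).2 fun z => ?_⟩
  · rw [← sum_marginal Prod.fst, hmarg, hk]
  · have h1 : ∑ z : A × A, (κ z.1 z.2 : ℝ) * ρ z.1 z.2 ≤ ∑ z, n * (p z * ρ z.1 z.2) := by
      refine sum_le_sum fun z _ => ?_
      by_cases h : z.2 = b₀ z.1
      · rw [h, hb₀]; simp
      · rw [← mul_assoc]
        exact mul_le_mul_of_nonneg_right (hκle z.1 z.2 h) (hρ _ _)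
    rw [← mul_sum] at h1
    exact h1.trans (mul_le_mul_of_nonneg_left hp.2.2 hn'.le)
  · rw [Real.dist_eq, le_div_iff₀ hn']
    refine le_trans (le_of_eq ?_) (hκp z.1 z.2)
    rw [show (κ z.1 z.2 : ℝ) - n * p (z.1, z.2) = (freq n (fun z => κ z.1 z.2) z - p z) * n by
      unfold freq; field_simp, abs_mul, abs_of_pos hn']

/-- Joint types achieve the rate function up to a vanishing error, uniformly in the type `k`. -/
lemma eventually_exists_jointType (w : A → ℝ) {ρ : A → A → ℝ} (hρ : ∀ a b, 0 ≤ ρ a b)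
    (hρ0 : ∀ a, ∃ b, ρ a b = 0) (D c : ℝ) {ε : ℝ} (hε : 0 < ε) :
    ∀ᶠ n : ℕ in atTop, ∀ k : A → ℕ, ∑ a, k a = n →
      (∀ c' > c, ∃ p ∈ couplings ρ D (freq n k), cost w p < c') →
      ∃ κ : A × A → ℕ, ∑ z, κ z = n ∧ marginal Prod.fst κ = k ∧
        ∑ z, (κ z : ℝ) * ρ z.1 z.2 ≤ n * D ∧ cost w (freq n κ) < c + ε := by
  have huc := (isCompact_stdSimplex ℝ (A × A)).uniformContinuousOn_of_continuous
    (continuous_cost w).continuousOn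
  obtain ⟨δ, hδ, hδc⟩ := Metric.uniformContinuousOn_iff.1 huc (ε / 2) (by positivity)
  have hlim : Tendsto (fun n : ℕ => (Fintype.card A : ℝ) / n) atTop (𝓝 0) :=
    tendsto_const_div_atTop_nhds_zero_nat _
  filter_upwards [hlim.eventually_lt_const hδ, eventually_gt_atTop 0] with n hnδ hn k hk hex
  obtain ⟨p, hp, hpc⟩ := hex (c + ε / 2) (by linarith)
  obtain ⟨κ, hκ, hκk, hκD, hκp⟩ := exists_jointType_near hρ hρ0 hk hn hp
  refine ⟨κ, hκ, hκk, hκD, ?_⟩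
  have := hδc _ (freq_mem_stdSimplex hκ hn) _ hp.1 (hκp.trans_lt hnδ)
  rw [Real.dist_eq, abs_lt] at this
  linarith

end SingleLetter

/-! ### Measures on finite sets in terms of their weights -/

section Weights

open Finset

lemma weights_mem_stdSimplex {α : Type*} [Fintype α] [MeasurableSpace α]
    [MeasurableSingletonClass α] (μ : Measure α) [IsProbabilityMeasure μ] :
    (fun x => μ.real {x}) ∈ stdSimplex ℝ α :=
  ⟨fun _ => measureReal_nonneg, by simp⟩

lemma exists_measure_of_mem_stdSimplex {α : Type*} [Fintype α] [MeasurableSpace α]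
    [MeasurableSingletonClass α] {p : α → ℝ} (hp : p ∈ stdSimplex ℝ α) :
    ∃ μ : ProbabilityMeasure α, ∀ x, (μ : Measure α).real {x} = p x := by
  let f : PMF α := PMF.ofFintype (fun x => ENNReal.ofReal (p x)) (by
    rw [← ENNReal.ofReal_sum_of_nonneg fun x _ => hp.1 x, hp.2, ENNReal.ofReal_one])
  refine ⟨⟨f.toMeasure, inferInstance⟩, fun x => ?_⟩
  rw [measureReal_def, ProbabilityMeasure.coe_mk, f.toMeasure_apply_singleton x
    (measurableSet_singleton x)]
  simp [f, hp.1 x]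

lemma measure_ext_real_singleton {α : Type*} [Fintype α] [MeasurableSpace α]
    [MeasurableSingletonClass α] {μ ν : Measure α} [IsFiniteMeasure μ] [IsFiniteMeasure ν]
    (h : ∀ x, μ.real {x} = ν.real {x}) : μ = ν :=
  Measure.ext_of_singleton fun x =>
    (ENNReal.toReal_eq_toReal_iff' (measure_ne_top _ _) (measure_ne_top _ _)).1 (h x)

lemma klDiv_eq_sum {α : Type*} [Fintype α] [MeasurableSpace α] [MeasurableSingletonClass α]
    (μ ν : Measure α) [IsProbabilityMeasure μ] [IsProbabilityMeasure ν]
    (h : ∀ x, ν {x} = 0 → μ {x} = 0) :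
    ((InformationTheory.klDiv μ ν : ENNReal) : EReal) =
      ((∑ x, μ.real {x} * Real.log (μ.real {x} / ν.real {x}) : ℝ) : EReal) := by
  have hac : μ ≪ ν := by
    intro s hs
    rw [← Set.biUnion_of_singleton s]
    refine (measure_biUnion_null_iff s.to_countable).2 fun x hx => h x ?_
    exact measure_mono_null (Set.singleton_subset_iff.2 hx) hs
  have hne : InformationTheory.klDiv μ ν ≠ ⊤ :=
    InformationTheory.klDiv_ne_top hac Integrable.of_finite
  have hll : ∀ x, μ.real {x} * llr μ ν x =
      μ.real {x} * Real.log (μ.real {x} / ν.real {x}) := by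
    intro x
    by_cases hx : ν {x} = 0
    · simp [measureReal_def, h x hx]
    · have h1 : μ {x} = μ.rnDeriv ν x * ν {x} := by
        conv_lhs => rw [← Measure.withDensity_rnDeriv_eq μ ν hac]
        rw [withDensity_apply _ (measurableSet_singleton x), lintegral_singleton]
      have h2 : μ.rnDeriv ν x = μ {x} / ν {x} := by
        rw [h1, ENNReal.mul_div_cancel_right hx (measure_ne_top _ _)]
      rw [llr, h2, ENNReal.toReal_div]
      rfl
  rw [← EReal.coe_toReal (x := (InformationTheory.klDiv μ ν : EReal)) (by simpa using hne)
    (EReal.coe_ennreal_ne_bot _), EReal.toReal_coe_ennreal,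
    InformationTheory.toReal_klDiv_of_measure_eq hac (by simp),
    integral_fintype Integrable.of_finite]
  simp only [smul_eq_mul, hll]

variable {A : Type*} [Fintype A] [DecidableEq A] [MeasurableSpace A] [DiscreteMeasurableSpace A]

lemma real_map_singleton {B : Type*} [MeasurableSpace B] [MeasurableSingletonClass B]
    [DecidableEq B] (μ : Measure A) [IsFiniteMeasure μ] (φ : A → B) (b : B) :
    (μ.map φ).real {b} = marginal φ (fun a => μ.real {a}) b := by
  rw [map_measureReal_apply .of_discrete (measurableSet_singleton b)]
  unfold marginal
  rw [sum_measureReal_singleton]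
  congr 1
  ext; simp

lemma mul_log_div_mul {x y z : ℝ} (hx : 0 ≤ x) (hxy : x ≤ y) (hxz : x ≤ z) :
    x * Real.log (x / (y * z)) = x * Real.log x - x * Real.log y - x * Real.log z := by
  rcases hx.eq_or_lt with rfl | hx
  · simp
  have hy := hx.trans_le hxy
  have hz := hx.trans_le hxz
  rw [Real.log_div hx.ne' (by positivity), Real.log_mul hy.ne' hz.ne']
  ring

lemma klDiv_prod_marginals (π : Measure (A × A)) [IsProbabilityMeasure π] :
    ((InformationTheory.klDiv π (π.fst.prod π.snd) : ENNReal) : EReal) =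
      ((entropy (marginal Prod.fst fun z => π.real {z}) +
        entropy (marginal Prod.snd fun z => π.real {z}) -
        entropy fun z => π.real {z} : ℝ) : EReal) := by
  set p : A × A → ℝ := fun z => π.real {z} with hp
  have hfst : ∀ a, π.fst.real {a} = marginal Prod.fst p a := fun a => real_map_singleton π _ a
  have hsnd : ∀ a, π.snd.real {a} = marginal Prod.snd p a := fun a => real_map_singleton π _ a
  have hprod : ∀ z : A × A, (π.fst.prod π.snd).real {z} =
      marginal Prod.fst p z.1 * marginal Prod.snd p z.2 := by
    rintro ⟨a, b⟩
    rw [← Set.singleton_prod_singleton, measureReal_prod_prod, hfst, hsnd]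
  have hp0 : ∀ z, 0 ≤ p z := fun z => measureReal_nonneg
  have hle1 : ∀ z, p z ≤ marginal Prod.fst p z.1 := fun z =>
    single_le_sum (f := p) (fun _ _ => hp0 _) (by simp)
  have hle2 : ∀ z, p z ≤ marginal Prod.snd p z.2 := fun z =>
    single_le_sum (f := p) (fun _ _ => hp0 _) (by simp)
  have hac : ∀ z, (π.fst.prod π.snd) {z} = 0 → π {z} = 0 := by
    intro z hz
    have h1 : marginal Prod.fst p z.1 * marginal Prod.snd p z.2 = 0 := by
      rw [← hprod z, measureReal_def, hz, ENNReal.toReal_zero]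
    have h2 : p z = 0 := by
      rcases mul_eq_zero.1 h1 with h | h
      · exact le_antisymm (h ▸ hle1 z) (hp0 z)
      · exact le_antisymm (h ▸ hle2 z) (hp0 z)
    exact (measureReal_eq_zero_iff).1 h2
  rw [klDiv_eq_sum _ _ hac]
  congr 1
  have h1 := sum_marginal_mul Prod.fst p fun a => Real.log (marginal Prod.fst p a)
  have h2 := sum_marginal_mul Prod.snd p fun a => Real.log (marginal Prod.snd p a)
  have h3 : ∀ z, π.real {z} * Real.log (π.real {z} / (π.fst.prod π.snd).real {z}) =
      p z * Real.log (p z) - p z * Real.log (marginal Prod.fst p z.1) -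
        p z * Real.log (marginal Prod.snd p z.2) := fun z => by
    rw [hprod z]; exact mul_log_div_mul (hp0 z) (hle1 z) (hle2 z)
  rw [sum_congr rfl fun z _ => h3 z, sum_sub_distrib, sum_sub_distrib, ← h1, ← h2]
  unfold entropy Real.negMulLog
  simp only [neg_mul, sum_neg_distrib]
  ring

/-- The rate function as an infimum of `cost` over weights. -/
lemma rateFn_eq (ρ : A → A → ℝ) (D : ℝ) (Q : Measure A) [IsProbabilityMeasure Q] (w : A → ℝ) :
    rateFn ρ D Q w = ⨅ p ∈ couplings ρ D fun a => Q.real {a}, (cost w p : EReal) := by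
  have hint : ∀ (π : ProbabilityMeasure (A × A)) (g : A × A → ℝ),
      ∫ z, g z ∂(π : Measure (A × A)) = ∑ z, (π : Measure (A × A)).real {z} * g z := by
    intro π g
    rw [integral_fintype Integrable.of_finite]
    simp
  have hterm : ∀ π : ProbabilityMeasure (A × A), (π : Measure (A × A)).fst = Q →
      ((InformationTheory.klDiv (π : Measure (A × A))
        (Q.prod (π : Measure (A × A)).snd) : ENNReal) : EReal) +
        ((∫ z, Real.log (w z.2) ∂(π : Measure (A × A)) : ℝ) : EReal) =
      (cost w fun z => (π : Measure (A × A)).real {z} : ℝ) := by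
    rintro π rfl
    rw [klDiv_prod_marginals, hint, ← EReal.coe_add,
      ← sum_marginal_mul Prod.snd _ fun b => Real.log (w b)]
    rfl
  have hfst : ∀ π : ProbabilityMeasure (A × A), ∀ a, (π : Measure (A × A)).fst.real {a} =
      marginal Prod.fst (fun z => (π : Measure (A × A)).real {z}) a :=
    fun π a => real_map_singleton _ _ a
  unfold rateFn
  apply le_antisymm
  · refine le_iInf₂ fun p hp => ?_
    obtain ⟨π, hπ⟩ := exists_measure_of_mem_stdSimplex hp.1
    have hπ' : (fun z => (π : Measure (A × A)).real {z}) = p := funext hπ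
    have hQ : (π : Measure (A × A)).fst = Q := measure_ext_real_singleton fun a => by
      rw [hfst, hπ', hp.2.1]
    refine (iInf_le _ π).trans ((iInf_le _ hQ).trans ((iInf_le _ ?_).trans ?_))
    · rw [hint]
      simpa [hπ] using hp.2.2
    · rw [hterm π hQ, hπ']
  · refine le_iInf fun π => le_iInf fun hQ => le_iInf fun hD => ?_
    rw [hterm π hQ]
    refine iInf₂_le _ ⟨weights_mem_stdSimplex _, ?_, ?_⟩
    · ext a
      rw [← hfst, hQ]
    · rwa [hint] at hD

lemma klDiv_eq_relEntropy (P Q : Measure A) [IsProbabilityMeasure P] [IsProbabilityMeasure Q]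
    (hP : ∀ a, 0 < P {a}) :
    ((InformationTheory.klDiv Q P : ENNReal) : EReal) =
      ((relEntropy (fun a => P.real {a}) fun a => Q.real {a} : ℝ) : EReal) := by
  rw [klDiv_eq_sum _ _ fun x hx => absurd hx (hP x).ne']
  congr 1
  unfold relEntropy entropy Real.negMulLog
  rw [← sum_neg_distrib, ← sum_sub_distrib]
  refine sum_congr rfl fun a _ => ?_
  have hPa : P.real {a} ≠ 0 := (measureReal_ne_zero_iff).2 (hP a).ne'
  by_cases hQ : Q.real {a} = 0
  · simp [hQ]
  rw [Real.log_div hQ hPa]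
  ring

lemma prodMeasure_coe (P : Measure A) [IsProbabilityMeasure P] (n : ℕ) (S : Finset (Fin n → A)) :
    prodMeasure P n S = ENNReal.ofReal (mass (fun a => P.real {a}) S) := by
  unfold prodMeasure mass
  rw [← sum_measure_singleton, ENNReal.ofReal_sum_of_nonneg
    fun x _ => prod_nonneg fun i _ => measureReal_nonneg]
  refine sum_congr rfl fun x _ => ?_
  rw [Measure.pi_singleton, ENNReal.ofReal_prod_of_nonneg fun i _ => measureReal_nonneg]
  exact prod_congr rfl fun i _ => (ofReal_measureReal).symm

lemma errorProb_coe (P : Measure A) [IsProbabilityMeasure P] (ρ : A → A → ℝ) (D : ℝ) {n : ℕ}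
    (hn : 0 < n) (C : Finset (Fin n → A)) :
    errorProb P ρ D n C = ENNReal.ofReal (mass (fun a => P.real {a}) (uncovered ρ D n C)) := by
  have hn' : (0 : ℝ) < n := by exact_mod_cast hn
  have : IsProbabilityMeasure (prodMeasure P n) := by unfold prodMeasure; infer_instance
  have hset : (uncovered ρ D n C : Set (Fin n → A)) = (blowup ρ D n C)ᶜ := by
    ext x
    rw [mem_coe, mem_uncovered, Set.mem_compl_iff, not_iff_not]
    simp only [blowup, ball, distortion, Set.mem_iUnion, Set.mem_ofPred_eq, mem_coe, exists_prop]
    refine exists_congr fun y => and_congr_right fun _ => ?_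
    rw [one_div, inv_mul_le_iff₀ hn']
  rw [← prodMeasure_coe, hset, prob_compl_eq_one_sub .of_discrete]
  rfl

end Weights

/-! ### Exponential rates -/

section Rates

lemma eventually_mul_polyLog_le (K : ℕ) {ε : ℝ} (hε : 0 < ε) :
    ∀ᶠ n : ℕ in atTop, K * polyLog n ≤ n * ε := by
  have h1 : Tendsto (fun n : ℕ => (n : ℝ) + 1) atTop atTop :=
    tendsto_atTop_add_const_right _ _ tendsto_natCast_atTop_atTop
  have h2 := (Real.tendsto_pow_log_div_mul_add_atTop 1 (-1) 1 one_ne_zero).comp h1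
  have h3 : Tendsto (fun n : ℕ => (1 : ℝ) / n) atTop (𝓝 0) :=
    tendsto_const_div_atTop_nhds_zero_nat 1
  have h4 := (h3.add h2).const_mul (K : ℝ)
  simp only [add_zero, mul_zero] at h4
  filter_upwards [h4.eventually_lt_const hε, eventually_gt_atTop 0] with n hn hn0
  have hn' : (0 : ℝ) < n := by exact_mod_cast hn0
  have h5 : (K : ℝ) * (1 / n + ((fun x => Real.log x ^ 1 / (1 * x + -1)) ∘
      fun n : ℕ => (n : ℝ) + 1) n) = K * polyLog n / n := by
    simp only [Function.comp_apply, pow_one, one_mul, add_neg_cancel_right, polyLog]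
    ring
  rw [h5, div_lt_iff₀ hn'] at hn
  linarith

lemma log_div_le_iff {n : ℕ} (hn : 0 < n) (x : ENNReal) (c : ℝ) :
    ENNReal.log x / (n : EReal) ≤ c ↔ x ≤ ENNReal.ofReal (Real.exp (n * c)) := by
  rw [EReal.div_le_iff_le_mul (by exact_mod_cast hn) (EReal.natCast_ne_top n),
    ← ENNReal.log_le_log_iff, ENNReal.log_ofReal_of_pos (Real.exp_pos _), Real.log_exp]
  push_cast
  rfl

lemma le_log_div_iff {n : ℕ} (hn : 0 < n) (x : ENNReal) (c : ℝ) :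
    c ≤ ENNReal.log x / (n : EReal) ↔ ENNReal.ofReal (Real.exp (n * c)) ≤ x := by
  rw [EReal.le_div_iff_mul_le (by exact_mod_cast hn) (EReal.natCast_ne_top n),
    ← ENNReal.log_le_log_iff, ENNReal.log_ofReal_of_pos (Real.exp_pos _), Real.log_exp, mul_comm]
  push_cast
  rfl

variable {A : Type*} [MeasurableSpace A] (P : Measure A) (ρ : A → A → ℝ) (D : ℝ)

lemma errorRate_le_iff {n : ℕ} (hn : 0 < n) (C : Set (Fin n → A)) (c : ℝ) :
    errorRate P ρ D n C ≤ c ↔ ENNReal.ofReal (Real.exp (-(n * c))) ≤ errorProb P ρ D n C := by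
  rw [errorRate, EReal.neg_le, ← EReal.coe_neg, le_log_div_iff hn, mul_neg]

lemma le_errorRate_iff {n : ℕ} (hn : 0 < n) (C : Set (Fin n → A)) (c : ℝ) :
    c ≤ errorRate P ρ D n C ↔ errorProb P ρ D n C ≤ ENNReal.ofReal (Real.exp (-(n * c))) := by
  rw [errorRate, EReal.le_neg, ← EReal.coe_neg, log_div_le_iff hn, mul_neg]

lemma probBound_iff (r : ℝ) (C : (n : ℕ) → Set (Fin n → A)) :
    ProbBound P r C ↔ ∀ c > -r, ∀ᶠ n : ℕ in atTop,
      prodMeasure P n (C n) ≤ ENNReal.ofReal (Real.exp (n * c)) := by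
  unfold ProbBound
  constructor
  · intro h c hc
    have h1 := eventually_lt_of_limsup_lt (h.trans_lt (EReal.coe_lt_coe_iff.2 hc))
    filter_upwards [h1, eventually_gt_atTop 0] with n hn hn0
    exact (log_div_le_iff hn0 _ c).1 hn.le
  · intro h
    refine EReal.le_of_forall_lt_iff_le.1 fun c hc => ?_
    refine limsup_le_of_le (h := ?_)
    filter_upwards [h c (EReal.coe_lt_coe_iff.1 hc), eventually_gt_atTop 0] with n hn hn0
    exact (log_div_le_iff hn0 _ c).2 hn

end Rates

/-! ### The optimal exponent in terms of weights -/

section Exponent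

/-- The rate function at the weights `q` is larger than `-r`. -/
def RateExceeds {A : Type*} [Fintype A] [DecidableEq A] (w : A → ℝ) (ρ : A → A → ℝ) (D r : ℝ)
    (q : A → ℝ) : Prop :=
  ∃ c > -r, ∀ p ∈ couplings ρ D q, c ≤ cost w p

variable {A : Type*} [Fintype A] [DecidableEq A] [MeasurableSpace A] [DiscreteMeasurableSpace A]
  (P : Measure A) [IsProbabilityMeasure P] {ρ : A → A → ℝ} {D r : ℝ}

lemma lt_rateFn_iff (w : A → ℝ) (Q : Measure A) [IsProbabilityMeasure Q] :
    ((-r : ℝ) : EReal) < rateFn ρ D Q w ↔ RateExceeds w ρ D r fun a => Q.real {a} := by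
  rw [rateFn_eq]
  constructor
  · intro h
    obtain ⟨c, hc1, hc2⟩ := EReal.lt_iff_exists_real_btwn.1 h
    exact ⟨c, EReal.coe_lt_coe_iff.1 hc1, fun p hp =>
      EReal.coe_le_coe_iff.1 (hc2.le.trans (iInf₂_le p hp))⟩
  · rintro ⟨c, hc, h⟩
    exact (EReal.coe_lt_coe_iff.2 hc).trans_le
      (le_iInf₂ fun p hp => EReal.coe_le_coe_iff.2 (h p hp))

lemma optExponent_eq (hP : ∀ a, 0 < P {a}) :
    optExponent P ρ r D = ⨅ q ∈ {q ∈ stdSimplex ℝ A | RateExceeds (fun a => P.real {a}) ρ D r q},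
      (relEntropy (fun a => P.real {a}) q : EReal) := by
  unfold optExponent
  apply le_antisymm
  · refine le_iInf₂ fun q hq => ?_
    obtain ⟨Q, hQ⟩ := exists_measure_of_mem_stdSimplex hq.1
    have hQ' : (fun a => (Q : Measure A).real {a}) = q := funext hQ
    refine (iInf₂_le Q ((lt_rateFn_iff _ _).2 (by rw [hQ']; exact hq.2))).trans ?_
    rw [klDiv_eq_relEntropy P Q hP, hQ']
  · refine le_iInf₂ fun Q hQ => ?_
    rw [klDiv_eq_relEntropy P Q hP]
    exact iInf₂_le _ ⟨weights_mem_stdSimplex _, (lt_rateFn_iff _ _).1 hQ⟩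

/-- The optimal exponent is positive: by upper semicontinuity the rate function stays below `-r`
near `P`, and away from `P` the relative entropy is bounded below. -/
lemma optExponent_pos (hP : ∀ a, 0 < P {a}) (hρ : ∀ a b, 0 ≤ ρ a b)
    (hρ0 : ∀ a, ∃ b, ρ a b = 0) (hrR : (r : EReal) < -rateFn ρ D P (fun a => P.real {a})) :
    0 < optExponent P ρ r D := by
  have hw : ∀ a, 0 < P.real {a} := fun a =>
    ENNReal.toReal_pos (hP a).ne' (measure_ne_top _ _)
  have h1 : rateFn ρ D P (fun a => P.real {a}) < ((-r : ℝ) : EReal) := by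
    rw [EReal.coe_neg]
    exact EReal.lt_neg_comm.1 hrR
  rw [rateFn_eq] at h1
  obtain ⟨p, hp⟩ := iInf_lt_iff.1 h1
  obtain ⟨hpc, hp⟩ := iInf_lt_iff.1 hp
  obtain ⟨δ, hδ, h2⟩ := exists_pos_le_relEntropy hw (weights_mem_stdSimplex P)
    (eventually_exists_cost_lt hw hρ hρ0 hpc (EReal.coe_lt_coe_iff.1 hp))
  rw [optExponent_eq P hP]
  refine lt_of_lt_of_le (EReal.coe_pos.2 hδ) (le_iInf₂ fun q hq => EReal.coe_le_coe_iff.2 ?_)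
  refine h2 q hq.1 fun ⟨p, hp, hpr⟩ => ?_
  obtain ⟨c, hc, hcp⟩ := hq.2
  linarith [hcp p hp]

end Exponent

/-! ### The converse -/

section Converse

open Finset

variable {A : Type*} [Fintype A] [DecidableEq A]

lemma freq_mem_couplings {ρ : A → A → ℝ} {D : ℝ} {n : ℕ} (hn : 0 < n) {k : A → ℕ}
    {κ : A × A → ℕ} (hκ : ∑ z, κ z = n) (hκk : marginal Prod.fst κ = k)
    (hκD : ∑ z, (κ z : ℝ) * ρ z.1 z.2 ≤ n * D) : freq n κ ∈ couplings ρ D (freq n k) := by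
  refine ⟨freq_mem_stdSimplex hκ hn, by rw [← freq_marginal, hκk], ?_⟩
  rw [← mul_sum_freq_mul hn fun z : A × A => ρ z.1 z.2] at hκD
  exact le_of_mul_le_mul_left hκD (by exact_mod_cast hn)

/-- All strings of a type class have the same mass, so counting the covered ones is enough. -/
lemma half_mass_le_mass_uncovered {w : A → ℝ} (hw : ∀ a, 0 < w a) {ρ : A → A → ℝ} {D : ℝ} {n : ℕ}
    {k : A → ℕ} (C : Finset (Fin n → A))
    (h : (#{x ∈ typeClass n k | ∃ y ∈ C, ∑ i, ρ (x i) (y i) ≤ n * D} : ℝ) ≤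
      1 / 2 * #(typeClass n k)) :
    1 / 2 * mass w (typeClass n k) ≤ mass w (uncovered ρ D n C) := by
  classical
  have h1 := card_filter_add_card_filter_not (s := typeClass n k)
    (fun x => ∃ y ∈ C, ∑ i, ρ (x i) (y i) ≤ n * D)
  set N : Finset (Fin n → A) :=
    {x ∈ typeClass n k | ¬ ∃ y ∈ C, ∑ i, ρ (x i) (y i) ≤ n * D} with hN
  have h2 : (#{x ∈ typeClass n k | ∃ y ∈ C, ∑ i, ρ (x i) (y i) ≤ n * D} : ℝ) + #N =
      #(typeClass n k) := by exact_mod_cast h1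
  have h3 : mass w N ≤ mass w (uncovered ρ D n C) :=
    mass_mono hw fun x hx => mem_uncovered.2 (mem_filter.1 hx).2
  refine le_trans ?_ h3
  rw [mass_eq_of_subset_typeClass hw subset_rfl,
    mass_eq_of_subset_typeClass hw (filter_subset _ _), ← mul_assoc]
  gcongr
  linarith

variable [MeasurableSpace A] [DiscreteMeasurableSpace A]
  (P : Measure A) [IsProbabilityMeasure P] {ρ : A → A → ℝ} {D r : ℝ}

/-- For types near a distribution `q` at which the rate function exceeds `-r`, at least half of the
type class is left uncovered, and the type class has mass about `exp (-n H(q ‖ P))`. -/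
lemma limsup_errorRate_le_relEntropy (hP : ∀ a, 0 < P {a}) {C : (n : ℕ) → Set (Fin n → A)}
    (hC : ProbBound P r C) {q : A → ℝ} (hq : q ∈ stdSimplex ℝ A)
    (hqr : RateExceeds (fun a => P.real {a}) ρ D r q) :
    limsup (fun n => errorRate P ρ D n (C n)) atTop ≤
      (relEntropy (fun a => P.real {a}) q : EReal) := by
  classical
  have : Nonempty A := by
    by_contra h
    rw [not_nonempty_iff] at h
    simpa using hq.2
  set w : A → ℝ := fun a => P.real {a} with hwdef
  have hw : ∀ a, 0 < w a := fun a => ENNReal.toReal_pos (hP a).ne' (measure_ne_top _ _)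
  obtain ⟨c', hc', hcost⟩ := hqr
  obtain ⟨c, hrc, hcc'⟩ := exists_between hc'
  obtain ⟨c₁, hrc₁, hc₁⟩ := exists_between hrc
  have hk : ∀ n : ℕ, ∃ k : A → ℕ, 0 < n →
      ∑ a, k a = n ∧ dist (freq n k) q ≤ Fintype.card A / n := by
    intro n
    rcases Nat.eq_zero_or_pos n with h | h
    · exact ⟨0, fun h' => absurd h h'.ne'⟩
    · obtain ⟨k, hk⟩ := exists_freq_near hq h
      exact ⟨k, fun _ => hk⟩
  choose k hk using hk
  have hlim : Tendsto (fun n => freq n (k n)) atTop (𝓝 q) := by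
    refine tendsto_iff_dist_tendsto_zero.2 (squeeze_zero'
      (Eventually.of_forall fun n => dist_nonneg) ?_ (tendsto_const_div_atTop_nhds_zero_nat (Fintype.card A : ℝ)))
    filter_upwards [eventually_gt_atTop 0] with n hn using (hk n hn).2
  have hrel : Tendsto (fun n => relEntropy w (freq n (k n))) atTop (𝓝 (relEntropy w q)) :=
    ((continuous_relEntropy w).tendsto q).comp hlim
  refine EReal.le_of_forall_lt_iff_le.1 fun z hz => limsup_le_of_le (h := ?_)
  obtain ⟨z', hz', hzz'⟩ := exists_between (EReal.coe_lt_coe_iff.1 hz)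
  set K := Fintype.card (A × A) + 2 * Fintype.card A + 1
  filter_upwards [eventually_gt_atTop 0, hlim.eventually (eventually_forall_lt_cost w hcc' hcost),
    hrel.eventually_lt_const hz', (probBound_iff P r C).1 hC c₁ hrc₁,
    eventually_mul_polyLog_le (K + 1) (sub_pos.2 hc₁),
    eventually_mul_polyLog_le (Fintype.card A + 1) (sub_pos.2 hzz')]
    with n hn hcn hreln hCn hK1 hK2
  obtain ⟨F, hF⟩ : ∃ F : Finset (Fin n → A), (F : Set (Fin n → A)) = C n :=
    ⟨(C n).toFinite.toFinset, by simp⟩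
  rw [errorRate_le_iff P ρ D hn, ← hF, errorProb_coe P ρ D hn]
  rw [← hF, prodMeasure_coe, ENNReal.ofReal_le_ofReal_iff (Real.exp_pos _).le] at hCn
  apply ENNReal.ofReal_le_ofReal
  have hn' : (0 : ℝ) < n := by exact_mod_cast hn
  have hL := one_le_polyLog n
  -- one `polyLog n ≥ 1` more than needed is kept in each exponent, and pays for the factor `1 / 2`
  have hexp : Real.exp (-1) ≤ 1 / 2 := by
    rw [Real.exp_neg, inv_le_comm₀ (Real.exp_pos _) (by norm_num)]
    linarith [Real.add_one_le_exp (1 : ℝ)]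
  have hcov := card_covered_le hw (ρ := ρ) (D := D) (c := c) (hk n hn).1 hn F
    fun κ hκ hκk hκD => (hcn _ (freq_mem_couplings hn hκ hκk hκD)).le
  have hhalf : (#{x ∈ typeClass n (k n) | ∃ y ∈ F, ∑ i, ρ (x i) (y i) ≤ n * D} : ℝ) ≤
      1 / 2 * #(typeClass n (k n)) := by
    refine hcov.trans (mul_le_mul_of_nonneg_right ?_ (Nat.cast_nonneg _))
    refine (mul_le_mul_of_nonneg_left hCn (Real.exp_pos _).le).trans ?_
    rw [← Real.exp_add]
    refine (Real.exp_le_exp.2 ?_).trans hexp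
    push_cast at hK1
    linarith
  refine le_trans ?_ (half_mass_le_mass_uncovered hw F hhalf)
  refine le_trans ?_ (mul_le_mul_of_nonneg_left
    (exp_le_mass_typeClass hw (hk n hn).1 hn) (by norm_num : (0 : ℝ) ≤ 1 / 2))
  refine le_trans ?_ (mul_le_mul_of_nonneg_right hexp (Real.exp_pos _).le)
  rw [← Real.exp_add]
  refine Real.exp_le_exp.2 ?_
  have := mul_le_mul_of_nonneg_left hreln.le hn'.le
  push_cast at hK2
  linarith

lemma limsup_errorRate_le_optExponent (hP : ∀ a, 0 < P {a}) {C : (n : ℕ) → Set (Fin n → A)}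
    (hC : ProbBound P r C) :
    limsup (fun n => errorRate P ρ D n (C n)) atTop ≤ optExponent P ρ r D := by
  rw [optExponent_eq P hP]
  exact le_iInf₂ fun q hq => limsup_errorRate_le_relEntropy P hP hC hq.1 hq.2

end Converse

/-! ### Optimal coverings -/

section Achievability

open Finset

variable {A : Type*} [Fintype A] [DecidableEq A]

/-- `C` covers `S`: every string of `S` is within distortion `D` of `C`. -/
def Covers (ρ : A → A → ℝ) (D : ℝ) {n : ℕ} (C S : Finset (Fin n → A)) : Prop :=
  ∀ x ∈ S, ∃ y ∈ C, ∑ i, ρ (x i) (y i) ≤ n * D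

/-- Taking coverings of least mass makes the code independent of the accuracy to which the rate
function is approximated. -/
lemma exists_covers_of_least_mass (w : A → ℝ) {ρ : A → A → ℝ} (hρ0 : ∀ a, ∃ b, ρ a b = 0) {D : ℝ}
    (hD : 0 ≤ D) {n : ℕ} (S : Finset (Fin n → A)) :
    ∃ C, Covers ρ D C S ∧ ∀ C', Covers ρ D C' S → mass w C ≤ mass w C' := by
  choose b₀ hb₀ using hρ0
  have huniv : Covers ρ D (univ : Finset (Fin n → A)) S := fun x _ =>
    ⟨fun i => b₀ (x i), mem_univ _, by simp only [hb₀, sum_const_zero]; positivity⟩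
  obtain ⟨C, hC, hmin⟩ := Set.exists_min_image {C : Finset (Fin n → A) | Covers ρ D C S} (mass w)
    (Set.toFinite _) ⟨univ, huniv⟩
  exact ⟨C, hC, hmin⟩

lemma not_rateExceeds_iff {w : A → ℝ} {ρ : A → A → ℝ} {D r : ℝ} {q : A → ℝ} :
    ¬ RateExceeds w ρ D r q ↔ ∀ c > -r, ∃ p ∈ couplings ρ D q, cost w p < c := by
  unfold RateExceeds
  push Not
  rfl

open scoped Classical in
/-- The union, over all types at which the rate function does not exceed `-r`, of coverings `code k`
of their type classes. -/
noncomputable def unionCode (w : A → ℝ) (ρ : A → A → ℝ) (D r : ℝ) (n : ℕ)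
    (code : (A → ℕ) → Finset (Fin n → A)) : Finset (Fin n → A) :=
  ({k ∈ piAntidiag univ n | ¬ RateExceeds w ρ D r (freq n k)} : Finset (A → ℕ)).biUnion code

/-- The mass of a union over types is at most polynomially larger than that of its largest part. -/
lemma mass_biUnion_types_le {w : A → ℝ} (hw : ∀ a, 0 < w a) {n : ℕ} (p : (A → ℕ) → Prop)
    [DecidablePred p] (F : (A → ℕ) → Finset (Fin n → A)) {M : ℝ} (hM : 0 ≤ M)
    (hF : ∀ k, ∑ a, k a = n → p k → mass w (F k) ≤ M) :
    mass w (({k ∈ piAntidiag univ n | p k} : Finset (A → ℕ)).biUnion F) ≤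
      Real.exp (Fintype.card A * polyLog n) * M := by
  refine (mass_biUnion_le hw _ _).trans ?_
  have h1 : ∀ k ∈ ({k ∈ piAntidiag univ n | p k} : Finset (A → ℕ)), mass w (F k) ≤ M := by
    intro k hk
    simp only [mem_filter, mem_piAntidiag, mem_univ, implies_true, and_true] at hk
    exact hF k hk.1 hk.2
  refine (sum_le_sum h1).trans ?_
  rw [sum_const, nsmul_eq_mul]
  refine mul_le_mul_of_nonneg_right (le_trans ?_ (add_one_pow_le_exp_polyLog n _)) hM
  exact_mod_cast (card_filter_le _ _).trans (card_piAntidiag_le A n)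

lemma eventually_mass_unionCode_le {w : A → ℝ} (hw : ∀ a, 0 < w a) {ρ : A → A → ℝ}
    (hρ : ∀ a b, 0 ≤ ρ a b) (hρ0 : ∀ a, ∃ b, ρ a b = 0) {D r c : ℝ} (hc : -r < c)
    (code : (n : ℕ) → (A → ℕ) → Finset (Fin n → A))
    (hcode : ∀ n k C, Covers ρ D C (typeClass n k) → mass w (code n k) ≤ mass w C) :
    ∀ᶠ n : ℕ in atTop, mass w (unionCode w ρ D r n (code n)) ≤ Real.exp (n * c) := by
  classical
  obtain ⟨c₁, hc₁, hc₁c⟩ := exists_between hc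
  set K := Fintype.card (A × A) + Fintype.card A + 3 with hK
  filter_upwards [eventually_exists_jointType w hρ hρ0 D (-r) (sub_pos.2 hc₁),
    eventually_mul_polyLog_le (Fintype.card A + K) (sub_pos.2 hc₁c), eventually_gt_atTop 0]
    with n hjoint hKn hn
  have hpart : ∀ k : A → ℕ, ∑ a, k a = n → ¬ RateExceeds w ρ D r (freq n k) →
      mass w (code n k) ≤ Real.exp (n * c₁ + K * polyLog n) := by
    intro k hk hkr
    obtain ⟨κ, hκ, hκk, hκD, hκc⟩ := hjoint k hk (not_rateExceeds_iff.1 hkr)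
    obtain ⟨C, hC, hCm⟩ := exists_cover_typeClass hw hκ hn
    rw [hκk] at hC
    refine (hcode n k C fun x hx => ?_).trans (hCm.trans (Real.exp_le_exp.2 ?_))
    · obtain ⟨y, hy, hxy⟩ := hC x hx
      refine ⟨y, hy, ?_⟩
      have := sum_comp_eq_sum_letterCount (fun i => (x i, y i)) fun z : A × A => ρ z.1 z.2
      rw [mem_typeClass.1 hxy] at this
      exact this.trans_le hκD
    · have : (n : ℝ) * cost w (freq n κ) ≤ n * c₁ := by gcongr; linarith
      linarith
  refine (mass_biUnion_types_le hw _ _ (Real.exp_pos _).le hpart).trans ?_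
  rw [← Real.exp_add]
  refine Real.exp_le_exp.2 ?_
  push_cast at hKn ⊢
  linarith

/-- Only types at which the rate function exceeds `-r` are left uncovered, and each of these type
classes has mass at most about `exp (-n c)`. -/
lemma mass_uncovered_unionCode_le {w : A → ℝ} (hw : ∀ a, 0 < w a) {ρ : A → A → ℝ} {D r c : ℝ}
    {n : ℕ} (hn : 0 < n) (code : (A → ℕ) → Finset (Fin n → A))
    (hcode : ∀ k, Covers ρ D (code k) (typeClass n k))
    (hc : ∀ q ∈ stdSimplex ℝ A, RateExceeds w ρ D r q → c ≤ relEntropy w q) :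
    mass w (uncovered ρ D n (unionCode w ρ D r n code)) ≤
      Real.exp ((Fintype.card A + 1 : ℕ) * polyLog n - n * c) := by
  classical
  have hsub : uncovered ρ D n (unionCode w ρ D r n code) ⊆
      ({k ∈ piAntidiag univ n | RateExceeds w ρ D r (freq n k)} : Finset (A → ℕ)).biUnion
        (typeClass n) := by
    intro x hx
    have hxn : letterCount x ∈ piAntidiag univ n := by simp [sum_letterCount]
    refine mem_biUnion.2 ⟨letterCount x, mem_filter.2 ⟨hxn, ?_⟩, mem_typeClass.2 rfl⟩
    by_contra hr
    obtain ⟨y, hy, hxy⟩ := hcode (letterCount x) x (mem_typeClass.2 rfl)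
    exact mem_uncovered.1 hx ⟨y, mem_biUnion.2 ⟨letterCount x, mem_filter.2 ⟨hxn, hr⟩, hy⟩, hxy⟩
  refine (mass_mono hw hsub).trans ((mass_biUnion_types_le hw _ _ (Real.exp_pos _).le
    (M := Real.exp (-(n * c) + polyLog n)) fun k hk hkr => ?_).trans ?_)
  · refine (mass_typeClass_le hw hk hn).trans (Real.exp_le_exp.2 ?_)
    have : (n : ℝ) * c ≤ n * relEntropy w (freq n k) := by
      gcongr
      exact hc _ (freq_mem_stdSimplex hk hn) hkr
    linarith
  · rw [← Real.exp_add]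
    refine Real.exp_le_exp.2 (le_of_eq ?_)
    push_cast
    ring

variable [MeasurableSpace A] [DiscreteMeasurableSpace A]
  (P : Measure A) [IsProbabilityMeasure P] {ρ : A → A → ℝ} {D : ℝ} (r : ℝ)

lemma exists_optExponent_le_liminf (hP : ∀ a, 0 < P {a}) (hρ : ∀ a b, 0 ≤ ρ a b)
    (hρ0 : ∀ a, ∃ b, ρ a b = 0) (hD : 0 ≤ D) :
    ∃ C : (n : ℕ) → Set (Fin n → A), ProbBound P r C ∧
      optExponent P ρ r D ≤ liminf (fun n => errorRate P ρ D n (C n)) atTop := by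
  set w : A → ℝ := fun a => P.real {a} with hwdef
  have hw : ∀ a, 0 < w a := fun a => ENNReal.toReal_pos (hP a).ne' (measure_ne_top _ _)
  choose code hcov hmin using fun (n : ℕ) (k : A → ℕ) =>
    exists_covers_of_least_mass w hρ0 hD (typeClass n k)
  refine ⟨fun n => unionCode w ρ D r n (code n), (probBound_iff P r _).2 fun c hc => ?_, ?_⟩
  · filter_upwards [eventually_mass_unionCode_le hw hρ hρ0 hc code hmin] with n hn
    rw [prodMeasure_coe]
    exact ENNReal.ofReal_le_ofReal hn
  · refine EReal.ge_of_forall_gt_iff_ge.1 fun c hc => ?_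
    obtain ⟨c', hcc', hc'⟩ := EReal.lt_iff_exists_real_btwn.1 hc
    refine le_liminf_of_le (h := ?_)
    filter_upwards [eventually_gt_atTop 0, eventually_mul_polyLog_le (Fintype.card A + 1)
      (sub_pos.2 (EReal.coe_lt_coe_iff.1 hcc'))] with n hn hKn
    rw [le_errorRate_iff P ρ D hn, errorProb_coe P ρ D hn]
    refine ENNReal.ofReal_le_ofReal ((mass_uncovered_unionCode_le hw hn (code n) (hcov n)
      (c := c') fun q hq hqr => ?_).trans (Real.exp_le_exp.2 ?_))
    · rw [optExponent_eq P hP] at hc'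
      exact EReal.coe_le_coe_iff.1 (hc'.le.trans (iInf₂_le q ⟨hq, hqr⟩))
    · linarith

end Achievability

end Covering

theorem corollary3 {A : Type*} [Finite A] [MeasurableSpace A] [DiscreteMeasurableSpace A]
    (P : Measure A) [IsProbabilityMeasure P] (hP : ∀ a, 0 < P {a})
    (ρ : A → A → ℝ) (hρ : ∀ a b, 0 ≤ ρ a b) (hρ0 : ∀ a, ∃ b, ρ a b = 0)
    (D r : ℝ) (hD : 0 ≤ D) (hr : 0 < r)
    (hrR : (r : EReal) < -Covering.rateFn ρ D P (fun a => P.real {a})) :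
    Covering.bestExponent P ρ r D = Covering.optExponent P ρ r D ∧
    (∀ C : (n : ℕ) → Set (Fin n → A), Covering.ProbBound P r C →
      limsup (fun n => Covering.errorRate P ρ D n (C n)) atTop ≤ Covering.optExponent P ρ r D) ∧
    (∃ C : (n : ℕ) → Set (Fin n → A), Covering.IsDCovering P ρ D C ∧ Covering.ProbBound P r C ∧
      Tendsto (fun n => Covering.errorRate P ρ D n (C n)) atTop
        (𝓝 (Covering.optExponent P ρ r D))) := by
  classical
  cases nonempty_fintype A
  have hconv := fun (C : (n : ℕ) → Set (Fin n → A)) (hC : Covering.ProbBound P r C) =>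
    Covering.limsup_errorRate_le_optExponent (ρ := ρ) (D := D) P hP hC
  obtain ⟨C, hC, hlim⟩ := Covering.exists_optExponent_le_liminf P r hP hρ hρ0 hD
  refine ⟨le_antisymm ?_ ?_, hconv, C, ?_, hC, ?_⟩
  · exact iSup₂_le fun C hC => (liminf_le_limsup).trans (hconv C hC)
  · exact hlim.trans (le_iSup₂ (f := fun (C : (n : ℕ) → Set (Fin n → A))
      (_ : Covering.ProbBound P r C) =>
        liminf (fun n => Covering.errorRate P ρ D n (C n)) atTop) C hC)
  · exact (Covering.optExponent_pos P hP hρ hρ0 hrR).trans_le hlim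
  · exact tendsto_of_le_liminf_of_limsup_le hlim (hconv C hC)
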